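/- **Feynman graphs.** Fix an abelian group $P$ of momenta (for instance $\mathbb R^d$) and real numbers $D$ (the dimension) and $c$. A Feynman graph $\Gamma$ is a finite multigraph (self-loops and multiple edges allowed, no isolated vertices, possibly empty or disconnected) in which each edge $e$ carries a mass $m_e\ge 0$ and a weight $\omega(e)\in\mathbb R$, and each vertex $v$ a weight $\omega(v)\in\mathbb R$ and the total external momentum $p_v\in P$ entering at $v$. The external vertices are those with $p_v\ne0$. In each connected component the momenta sum to $0$ and are non-exceptional: no nonempty proper subset of the external momenta of the component sums to $0$. Isomorphic graphs are identified. $\Gamma$ is scaleless if it has no massive edges and no external vertices. For a set $\gamma$ of edges with its end points, let $L_\gamma$ be its number of loops and $\omega(\gamma)=D L_\gamma+\sum_{v\in V_\gamma}\omega(v)-\sum_{e\in E_\gamma}\omega(e)$. **Subgraphs and contractions.** Subgraphs $\gamma\subseteq\Gamma$ correspond to sets of edges; the vertices of $\gamma$ are the end points of its edges. $\gamma$ is mass-momentum-spanning (mm) in $\Gamma$ if it contains all massive edges of $\Gamma$ and some connected component of $\gamma$ contains all external vertices of $\Gamma$ (if $\Gamma$ is disconnected: for each component of $\Gamma$, its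 external vertices lie in one component of $\gamma$; this is an empty condition where there are no external vertices). An mm subgraph inherits all masses and external momenta of $\Gamma$; a subgraph that is not mm inherits no external momenta and all its masses are $0$. Weights are always inherited. A Feynman graph $\Gamma$ is motic if every proper subgraph that is mm in $\Gamma$ has strictly fewer loops than $\Gamma$; a subgraph is motic if it is motic as a Feynman graph with the inherited data. In $\Gamma/\gamma$ each connected component of $\gamma$ is contracted to one vertex, of weight $c$, at which its external momenta are added up; all other labels are kept and isolated vertices are discarded, so that $\Gamma/\Gamma$ is the empty graph. The usual scalar case is $\omega(e)=2$, $\omega(v)=c=0$. **Coproduct and projections.** Let $\mathcal M$ be the $\mathbb Q$-vector space with the isomorphism classes of motic graphs as a basis, and let $\Delta_{\mathcal M}:\mathcal M\to\mathcal M\otimes\mathcal M$ be the linear map $$\Delta_{\mathcal M}(\Gamma)=\sum_{\gamma\subseteq\Gamma\text{ motic}}\gamma\otimes\Gamma/\gamma .$$ Let $\mathcal H^{UV}\subseteq\mathcal M$ be spanned by the motic graphs all of whose connected components $\delta$ are 1PI with $\omega(\delta)\ge0$, and let $\mathcal H^{IR}\subseteq\mathcal M$ be spanned by the scaleless motic graphs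 all of whose pieces $\delta$ satisfy $\omega(\delta)\le0$. Here "pieces" may be read either as the biconnected components or as the connected components of the graph; the theorem holds for both. Let $\rho^{UV}:\mathcal M\to\mathcal H^{UV}$ and $\rho^{IR}:\mathcal M\to\mathcal H^{IR}$ be the projections that map all other motic graphs to $0$, and put $$\Delta^{UV}=(\rho^{UV}\otimes\mathrm{id})\circ\Delta_{\mathcal M}:\mathcal M\to\mathcal H^{UV}\otimes\mathcal M,\qquad \Delta^{IR}=(\mathrm{id}\otimes\rho^{IR})\circ\Delta_{\mathcal M}:\mathcal M\to\mathcal M\otimes\mathcal H^{IR}.$$ **Theorem.** As linear maps $\mathcal M\to\mathcal H^{UV}\otimes\mathcal M\otimes\mathcal H^{IR}$, $$(\mathrm{id}\otimes\Delta^{IR})\circ\Delta^{UV}=(\Delta^{UV}\otimes\mathrm{id})\circ\Delta^{IR}=(\rho^{UV}\otimes\mathrm{id}\otimes\rho^{IR})\circ\Delta^{(2)}_{\mathcal M},$$ where $\Delta^{(2)}_{\mathcal M}=(\Delta_{\mathcal M}\otimes\mathrm{id})\circ\Delta_{\mathcal M}=(\mathrm{id}\otimes\Delta_{\mathcal M})\circ\Delta_{\mathcal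 M}$ (this equality is part of the assertion). -/

import Mathlib

open scoped TensorProduct NNReal Classical

/-! ## Connectivity of multigraphs -/

/-- Two vertices are related when they are joined by a path of edges from `γ`. -/
def edgeConn {V E : Type} (ends : E → Sym2 V) (γ : Finset E) : Setoid V :=
  Relation.EqvGen.setoid (fun u v => ∃ e ∈ γ, ends e = s(u, v))

/-- Feynman graphs with momenta in `P`: finite multigraphs (self-loops and parallel edges allowed)
without isolated vertices. Every edge `e` carries a mass and its power-counting weight `ω(e)`, every
vertex `v` its weight `ω(v)` and the total external momentum entering at `v`; the external vertices
are those with nonzero momentum. In every connected component the momentum is conserved and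
non-exceptional. -/
structure FeynmanGraph (P : Type*) [AddCommGroup P] where
  V : Type
  E : Type
  [fintypeV : Fintype V]
  [fintypeE : Fintype E]
  ends : E → Sym2 V
  mass : E → ℝ≥0
  edgeWeight : E → ℝ
  vertexWeight : V → ℝ
  momentum : V → P
  exists_edge : ∀ v, ∃ e, v ∈ ends e
  conservation : ∀ u, ∑ v with edgeConn ends Finset.univ u v, momentum v = 0
  /-- A nonempty set `S` of external vertices of one component, whose momenta sum to zero, consists
  of all the external vertices of this component. -/
  nonexceptional : ∀ S : Finset V, S.Nonempty → (∀ v ∈ S, momentum v ≠ 0) →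
    (∀ u ∈ S, ∀ v ∈ S, edgeConn ends Finset.univ u v) → ∑ v ∈ S, momentum v = 0 →
    ∀ u ∈ S, ∀ v, edgeConn ends Finset.univ u v → momentum v ≠ 0 → v ∈ S

attribute [instance] FeynmanGraph.fintypeV FeynmanGraph.fintypeE

theorem edgeConn_refl {V E : Type} {ends : E → Sym2 V} {γ : Finset E} (u : V) :
    edgeConn ends γ u u := (edgeConn ends γ).refl' u

theorem edgeConn_symm {V E : Type} {ends : E → Sym2 V} {γ : Finset E} {u v : V}
    (h : edgeConn ends γ u v) : edgeConn ends γ v u := (edgeConn ends γ).symm' h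

theorem edgeConn_trans {V E : Type} {ends : E → Sym2 V} {γ : Finset E} {u v w : V}
    (h : edgeConn ends γ u v) (h' : edgeConn ends γ v w) : edgeConn ends γ u w :=
  (edgeConn ends γ).trans' h h'

theorem edgeConn_of_edge {V E : Type} {ends : E → Sym2 V} {γ : Finset E} {e : E} (he : e ∈ γ)
    {u v : V} (h : ends e = s(u, v)) : edgeConn ends γ u v :=
  Relation.EqvGen.rel _ _ ⟨e, he, h⟩

theorem edgeConn_of_mem {V E : Type} {ends : E → Sym2 V} {γ : Finset E} {e : E} (he : e ∈ γ)
    {u v : V} (hu : u ∈ ends e) (hv : v ∈ ends e) : edgeConn ends γ u v := by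
  by_cases h : u = v
  · subst h; exact (edgeConn ends γ).refl _
  · exact edgeConn_of_edge he (((Sym2.mem_and_mem_iff h).1 ⟨hu, hv⟩))

/-- Induction principle: a setoid relating the ends of every edge of `γ` contains `edgeConn`. -/
theorem edgeConn_le {V E : Type} {ends : E → Sym2 V} {γ : Finset E} {r : V → V → Prop}
    (hr : Equivalence r) (h : ∀ e ∈ γ, ∀ u v, ends e = s(u, v) → r u v) {u v : V}
    (huv : edgeConn ends γ u v) : r u v := by
  induction huv with
  | rel _ _ h' => obtain ⟨e, he, h'⟩ := h'; exact h e he _ _ h'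
  | refl _ => exact hr.refl _
  | symm _ _ _ ih => exact hr.symm ih
  | trans _ _ _ _ _ ih1 ih2 => exact hr.trans ih1 ih2

theorem edgeConn_mono {V E : Type} {ends : E → Sym2 V} {γ δ : Finset E} (h : γ ⊆ δ) {u v : V}
    (huv : edgeConn ends γ u v) : edgeConn ends δ u v :=
  edgeConn_le (edgeConn ends δ).iseqv (fun _ he _ _ h' => edgeConn_of_edge (h he) h') huv

namespace FeynmanGraph

variable {P : Type*} [AddCommGroup P]

/-- The vertices of the subgraph with edge set `γ`. -/
noncomputable def verts (G : FeynmanGraph P) (γ : Finset G.E) : Finset G.V :=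
  {v | ∃ e ∈ γ, v ∈ G.ends e}

/-- The loop number (first Betti number) of the subgraph with edge set `γ`. The vertices of `G`
outside the subgraph are included: each is a component of its own and the sum does not change. -/
noncomputable def loops (G : FeynmanGraph P) (γ : Finset G.E) : ℤ :=
  (γ.card : ℤ) - Fintype.card G.V + Nat.card (Quotient (edgeConn G.ends γ))

def IsExternal (G : FeynmanGraph P) (v : G.V) : Prop := G.momentum v ≠ 0

theorem sum_filter_external (G : FeynmanGraph P) (S : Finset G.V) :
    ∑ v ∈ S with G.IsExternal v, G.momentum v = ∑ v ∈ S, G.momentum v :=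
  Finset.sum_subset (Finset.filter_subset _ _) (fun v hv h => by
    by_contra h0; exact h (Finset.mem_filter.2 ⟨hv, h0⟩))

/-- All massive edges belong to `γ`. -/
def MassSpanning (G : FeynmanGraph P) (γ : Finset G.E) : Prop :=
  ∀ e, G.mass e ≠ 0 → e ∈ γ

/-- One connected component of `γ` contains all the external vertices (of each component of `G`,
if `G` is disconnected). -/
def MomentumSpanning (G : FeynmanGraph P) (γ : Finset G.E) : Prop :=
  ∀ u v, G.IsExternal u → G.IsExternal v → edgeConn G.ends Finset.univ u v → edgeConn G.ends γ u v

def MM (G : FeynmanGraph P) (γ : Finset G.E) : Prop :=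
  G.MassSpanning γ ∧ G.MomentumSpanning γ

/-- No external momenta and no masses. -/
def Scaleless (G : FeynmanGraph P) : Prop :=
  (∀ e, G.mass e = 0) ∧ ∀ v, ¬ G.IsExternal v

/-- A graph is motic if all its proper mass-momentum-spanning subgraphs have fewer loops. -/
def IsMotic (G : FeynmanGraph P) : Prop :=
  ∀ μ : Finset G.E, μ ≠ Finset.univ → G.MM μ → G.loops μ < G.loops Finset.univ

/-! ### Subgraphs -/

section sub

variable (G : FeynmanGraph P) (γ : Finset G.E)

/-- The end points of the edges of the subgraph `γ`. -/
def subEnds (e : {e // e ∈ γ}) : Sym2 {v // v ∈ G.verts γ} :=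
  (G.ends e).attachWith (fun v hv => by
    simp only [verts, Finset.mem_filter, Finset.mem_univ, true_and]
    exact ⟨e.1, e.2, hv⟩)

theorem subEnds_map (e : {e // e ∈ γ}) : (G.subEnds γ e).map Subtype.val = G.ends e :=
  Sym2.attachWith_map_subtypeVal _

theorem subEnds_conn (u v : {v // v ∈ G.verts γ}) :
    edgeConn (G.subEnds γ) Finset.univ u v ↔ edgeConn G.ends γ u.1 v.1 := by
  constructor
  · intro h
    refine edgeConn_le (r := fun u v => edgeConn G.ends γ u.1 v.1)
      ⟨fun _ => edgeConn_refl _, fun h => edgeConn_symm h, fun h h2 => edgeConn_trans h h2⟩ ?_ h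
    intro e _ u v h
    have := G.subEnds_map γ e
    rw [h, Sym2.map_mk] at this
    exact edgeConn_of_edge e.2 this.symm
  · intro h
    have key : u.1 = v.1 ∨ ∃ a b : {v // v ∈ G.verts γ}, a.1 = u.1 ∧ b.1 = v.1 ∧
        edgeConn (G.subEnds γ) Finset.univ a b := by
      refine edgeConn_le (r := fun x y => x = y ∨ ∃ a b : {v // v ∈ G.verts γ}, a.1 = x ∧
        b.1 = y ∧ edgeConn (G.subEnds γ) Finset.univ a b) ⟨fun _ => .inl rfl, ?_, ?_⟩ ?_ h
      · rintro x y (h | ⟨a, b, ha, hb, h⟩)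
        · exact .inl h.symm
        · exact .inr ⟨b, a, hb, ha, edgeConn_symm h⟩
      · rintro x y z (rfl | ⟨a, b, ha, hb, h⟩) h2
        · exact h2
        · rcases h2 with rfl | ⟨a', b', ha', hb', h'⟩
          · exact .inr ⟨a, b, ha, hb, h⟩
          · have : b = a' := Subtype.ext (hb.trans ha'.symm)
            subst this
            exact .inr ⟨a, b', ha, hb', edgeConn_trans h h'⟩
      · intro e he x y hxy
        have hm := G.subEnds_map γ ⟨e, he⟩
        have hx : x ∈ G.verts γ := by simpa [verts] using ⟨e, he, by simp [hxy]⟩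
        have hy : y ∈ G.verts γ := by simpa [verts] using ⟨e, he, by simp [hxy]⟩
        refine .inr ⟨⟨x, hx⟩, ⟨y, hy⟩, rfl, rfl, edgeConn_of_edge (Finset.mem_univ ⟨e, he⟩) ?_⟩
        apply Sym2.map.injective Subtype.val_injective
        exact hm.trans hxy
    rcases key with h | ⟨a, b, ha, hb, h⟩
    · rw [Subtype.ext h]
    · rwa [Subtype.ext ha, Subtype.ext hb] at h

theorem exists_ne_external (u : G.V) (hu : G.IsExternal u) :
    ∃ v, v ≠ u ∧ G.IsExternal v ∧ edgeConn G.ends Finset.univ u v := by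
  by_contra! h
  have := G.conservation u
  rw [Finset.sum_eq_single u] at this
  · exact hu this
  · intro v hv hne
    by_contra h0
    exact h v hne h0 (by simpa using hv)
  · intro h'; simp at h'

theorem eq_of_edgeConn_of_notMem {u v : G.V} (hu : u ∉ G.verts γ) (h : edgeConn G.ends γ u v) :
    u = v := by
  refine (edgeConn_le (r := fun x y => x = y ∨ (x ∈ G.verts γ ∧ y ∈ G.verts γ))
    ⟨fun _ => .inl rfl, ?_, ?_⟩ ?_ h).resolve_right (fun h => hu h.1)
  · rintro x y (h | h)
    · exact .inl h.symm
    · exact .inr h.symm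
  · rintro x y z (rfl | h) h2
    · exact h2
    · rcases h2 with rfl | h2
      · exact .inr h
      · exact .inr ⟨h.1, h2.2⟩
  · intro e he x y hxy
    exact .inr ⟨by simpa [verts] using ⟨e, he, by simp [hxy]⟩,
      by simpa [verts] using ⟨e, he, by simp [hxy]⟩⟩

theorem mem_verts_of_external (h : G.MM γ) {u : G.V} (hu : G.IsExternal u) : u ∈ G.verts γ := by
  obtain ⟨v, hne, hv, hc⟩ := G.exists_ne_external u hu
  by_contra h'
  exact hne (G.eq_of_edgeConn_of_notMem γ h' (h.2 u v hu hv hc)).symm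

/-- The subgraph with edge set `γ`, as a Feynman graph: its vertices are the end points of its
edges, and it inherits all masses and external momenta of `G` if it is mass-momentum-spanning, and
none of them otherwise. -/
noncomputable def sub : FeynmanGraph P where
  V := {v // v ∈ G.verts γ}
  E := {e // e ∈ γ}
  ends := G.subEnds γ
  mass e := if G.MM γ then G.mass e else 0
  edgeWeight e := G.edgeWeight e
  vertexWeight v := G.vertexWeight v
  momentum v := if G.MM γ then G.momentum v else 0
  exists_edge := by
    rintro ⟨v, hv⟩
    obtain ⟨e, he, hve⟩ := by simpa [verts] using hv
    refine ⟨⟨e, he⟩, ?_⟩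
    have := G.subEnds_map γ ⟨e, he⟩
    rw [← this] at hve
    obtain ⟨a, ha, rfl⟩ := Sym2.mem_map.1 hve
    exact ha
  conservation := by
    intro u
    by_cases hm : G.MM γ
    · simp only [hm, if_true, G.subEnds_conn]
      by_cases h0 : ∃ w, G.IsExternal w ∧ edgeConn G.ends γ u.1 w
      · obtain ⟨w, hw, huw⟩ := h0
        rw [← G.conservation u.1]
        refine Finset.sum_bij_ne_zero (fun v _ _ => v.1) ?_ ?_ ?_ ?_
        · intro v hv _
          simpa using edgeConn_mono (Finset.subset_univ _) (by simpa using hv)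
        · intro a _ _ b _ _ h; exact Subtype.ext h
        · intro v hv h
          refine ⟨⟨v, G.mem_verts_of_external γ hm h⟩, ?_, h, rfl⟩
          have hv' : edgeConn G.ends Finset.univ u.1 v := by simpa using hv
          have := hm.2 w v hw h
            (edgeConn_trans (edgeConn_symm (edgeConn_mono (Finset.subset_univ _) huw)) hv')
          simpa using edgeConn_trans huw this
        · intros; rfl
      · apply Finset.sum_eq_zero
        intro v hv
        by_contra h
        exact h0 ⟨v, h, by simpa using hv⟩
    · simp [hm]
  nonexceptional := by
    intro S hS hne hc hsum u hu v huv hv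
    by_cases hm : G.MM γ
    · simp only [hm, if_true, G.subEnds_conn] at hne hc hsum huv hv
      have := G.nonexceptional (S.map ⟨Subtype.val, Subtype.val_injective⟩) (by simpa using hS)
        (by simpa using fun a b h => hne _ h)
        (by
          intro a ha b hb
          simp only [Finset.mem_map, Function.Embedding.coeFn_mk] at ha hb
          obtain ⟨a, ha, rfl⟩ := ha
          obtain ⟨b, hb, rfl⟩ := hb
          exact edgeConn_mono (Finset.subset_univ _) (hc a ha b hb))
        (by simpa using hsum) u.1 (by simpa using hu) v.1
        (edgeConn_mono (Finset.subset_univ _) huv) hv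
      simpa using this
    · simp [hm] at hv

end sub

/-! ### Contractions -/

section contract

variable (G : FeynmanGraph P) (γ : Finset G.E)

/-- The vertices of `G / γ`: the classes of vertices of `G` joined by `γ`, as far as they meet an
edge outside `γ`. So no isolated vertices arise, and `G / G` is the empty graph. -/
abbrev ConVert : Type :=
  {q : Quotient (edgeConn G.ends γ) // ∃ e, e ∉ γ ∧ q ∈ (G.ends e).map (Quotient.mk _)}

def conEnds (e : {e // e ∉ γ}) : Sym2 (G.ConVert γ) :=
  ((G.ends e).map (Quotient.mk (edgeConn G.ends γ))).attachWith (fun _ hq => ⟨e.1, e.2, hq⟩)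

theorem conEnds_map (e : {e // e ∉ γ}) :
    (G.conEnds γ e).map Subtype.val = (G.ends e).map (Quotient.mk (edgeConn G.ends γ)) :=
  Sym2.attachWith_map_subtypeVal _

/-- The preimage in `G` of a subgraph of `G / γ`. -/
noncomputable def conLift (μ : Finset {e // e ∉ γ}) : Finset G.E :=
  γ ∪ μ.map ⟨Subtype.val, Subtype.val_injective⟩

theorem subset_conLift (μ : Finset {e // e ∉ γ}) : γ ⊆ G.conLift γ μ :=
  Finset.subset_union_left

theorem mem_conLift (μ : Finset {e // e ∉ γ}) {e : G.E} (he : e ∉ γ) :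
    e ∈ G.conLift γ μ ↔ ⟨e, he⟩ ∈ μ := by
  simp [conLift, he]

theorem conLift_univ : G.conLift γ Finset.univ = Finset.univ := by
  ext e
  by_cases he : e ∈ γ
  · simp [G.subset_conLift γ _ he]
  · simp [G.mem_conLift γ _ he]

theorem conEnds_conn_aux (μ : Finset {e // e ∉ γ}) {u v : G.V}
    (h : edgeConn G.ends (G.conLift γ μ) u v) : edgeConn G.ends γ u v ∨
      ∃ a b : G.ConVert γ, a.1 = Quotient.mk _ u ∧ b.1 = Quotient.mk _ v ∧
        edgeConn (G.conEnds γ) μ a b := by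
  refine edgeConn_le (r := fun x y => edgeConn G.ends γ x y ∨
    ∃ a b : G.ConVert γ, a.1 = Quotient.mk _ x ∧ b.1 = Quotient.mk _ y ∧
      edgeConn (G.conEnds γ) μ a b) ⟨fun _ => .inl (edgeConn_refl _), ?_, ?_⟩ ?_ h
  · rintro x y (h | ⟨a, b, ha, hb, h⟩)
    · exact .inl (edgeConn_symm h)
    · exact .inr ⟨b, a, hb, ha, edgeConn_symm h⟩
  · rintro x y z (h | ⟨a, b, ha, hb, h⟩) (h' | ⟨a', b', ha', hb', h'⟩)
    · exact .inl (edgeConn_trans h h')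
    · exact .inr ⟨a', b', ha'.trans (Quotient.sound h).symm, hb', h'⟩
    · exact .inr ⟨a, b, ha, hb.trans (Quotient.sound h'), h⟩
    · have : b = a' := Subtype.ext (hb.trans ha'.symm)
      subst this
      exact .inr ⟨a, b', ha, hb', edgeConn_trans h h'⟩
  · intro e he x y hxy
    by_cases heγ : e ∈ γ
    · exact .inl (edgeConn_of_edge heγ hxy)
    · refine .inr ⟨⟨Quotient.mk _ x, e, heγ, by simp [hxy]⟩, ⟨Quotient.mk _ y, e, heγ,
        by simp [hxy]⟩, rfl, rfl, edgeConn_of_edge ((G.mem_conLift γ μ heγ).1 he) ?_⟩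
      apply Sym2.map.injective Subtype.val_injective
      exact (G.conEnds_map γ _).trans (congrArg (Sym2.map _) hxy)

theorem conEnds_conn (μ : Finset {e // e ∉ γ}) {a b : G.ConVert γ} {u v : G.V}
    (ha : a.1 = Quotient.mk _ u) (hb : b.1 = Quotient.mk _ v) :
    edgeConn (G.conEnds γ) μ a b ↔ edgeConn G.ends (G.conLift γ μ) u v := by
  have hγ {x y : G.V} (h : (Quotient.mk (edgeConn G.ends γ) x) = Quotient.mk _ y) :
      edgeConn G.ends (G.conLift γ μ) x y :=
    edgeConn_mono (G.subset_conLift γ μ) (Quotient.exact h)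
  constructor
  · intro h
    refine edgeConn_le (r := fun a b : G.ConVert γ => ∀ u v, a.1 = Quotient.mk _ u →
      b.1 = Quotient.mk _ v → edgeConn G.ends (G.conLift γ μ) u v) ⟨?_, ?_, ?_⟩ ?_ h u v ha hb
    · intro a u v hu hv; exact hγ (hu.symm.trans hv)
    · intro a b h u v hu hv; exact edgeConn_symm (h v u hv hu)
    · intro a b c h h' u v hu hv
      obtain ⟨w, hw⟩ := Quotient.exists_rep b.1
      exact edgeConn_trans (h u w hu hw.symm) (h' w v hw.symm hv)
    · intro e he a b hab u v hu hv
      have hm := G.conEnds_map γ e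
      rw [hab, Sym2.map_mk, hu, hv] at hm
      have hxu : Quotient.mk _ u ∈ (G.ends e.1).map (Quotient.mk (edgeConn G.ends γ)) := by
        rw [← hm]; simp
      have hxv : Quotient.mk _ v ∈ (G.ends e.1).map (Quotient.mk (edgeConn G.ends γ)) := by
        rw [← hm]; simp
      obtain ⟨x, hx, hxu⟩ := Sym2.mem_map.1 hxu
      obtain ⟨y, hy, hyv⟩ := Sym2.mem_map.1 hxv
      exact edgeConn_trans (hγ hxu.symm) (edgeConn_trans
        (edgeConn_of_mem ((G.mem_conLift γ μ e.2).2 he) hx hy) (hγ hyv))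
  · intro h
    rcases G.conEnds_conn_aux γ μ h with h | ⟨a', b', ha', hb', h⟩
    · rw [Subtype.ext (ha.trans ((Quotient.sound h).trans hb.symm))]
    · rwa [Subtype.ext (ha'.trans ha.symm), Subtype.ext (hb'.trans hb.symm)] at h

theorem conEnds_conn_univ {a b : G.ConVert γ} {u v : G.V}
    (ha : a.1 = Quotient.mk _ u) (hb : b.1 = Quotient.mk _ v) :
    edgeConn (G.conEnds γ) Finset.univ a b ↔ edgeConn G.ends Finset.univ u v := by
  rw [G.conEnds_conn γ _ ha hb, conLift_univ]

/-- The total momentum entering at a vertex of `G / γ`. -/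
noncomputable def conMomentum (q : G.ConVert γ) : P :=
  ∑ v with Quotient.mk _ v = q.1, G.momentum v

theorem sum_conMomentum (S : Finset (G.ConVert γ)) : ∑ q ∈ S, G.conMomentum γ q =
    ∑ v with ∃ q ∈ S, Quotient.mk _ v = q.1, G.momentum v := by
  unfold conMomentum
  rw [← Finset.sum_biUnion]
  · apply Finset.sum_congr _ (fun _ _ => rfl)
    ext v; simp
  · intro a _ b _ hab
    rw [Function.onFun, Finset.disjoint_left]
    intro v hv hv'
    simp only [Finset.mem_filter, Finset.mem_univ, true_and] at hv hv'
    exact hab (Subtype.ext (hv.symm.trans hv'))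

theorem exists_external_of_conMomentum {q : G.ConVert γ} (h : G.conMomentum γ q ≠ 0) :
    ∃ v, Quotient.mk _ v = q.1 ∧ G.IsExternal v := by
  obtain ⟨v, hv, h⟩ := Finset.exists_ne_zero_of_sum_ne_zero h
  exact ⟨v, by simpa using hv, h⟩

/-- The contraction `G / γ`: every connected component of `γ` is contracted to one vertex, of weight
`c`, and the edges of `γ` are deleted. Other vertices and edges keep their labels, and the external
momenta entering at the vertices of a contracted component add up. -/
noncomputable def contract (c : ℝ) : FeynmanGraph P where
  V := G.ConVert γ
  E := {e // e ∉ γ}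
  ends := G.conEnds γ
  mass e := G.mass e
  edgeWeight e := G.edgeWeight e
  vertexWeight q := if ∃ v ∈ G.verts γ, Quotient.mk _ v = q.1 then c
    else ∑ v with Quotient.mk _ v = q.1, G.vertexWeight v
  momentum := G.conMomentum γ
  exists_edge := by
    rintro ⟨q, e, he, hq⟩
    refine ⟨⟨e, he⟩, ?_⟩
    rw [← G.conEnds_map γ ⟨e, he⟩] at hq
    obtain ⟨a, ha, rfl⟩ := Sym2.mem_map.1 hq
    exact ha
  conservation := by
    intro q
    obtain ⟨u, hu⟩ := Quotient.exists_rep q.1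
    rw [sum_conMomentum, ← G.conservation u]
    apply Finset.sum_congr _ (fun _ _ => rfl)
    ext v
    simp only [Finset.mem_filter, Finset.mem_univ, true_and]
    constructor
    · rintro ⟨q', h, hv⟩
      exact (G.conEnds_conn_univ γ hu.symm hv.symm).1 h
    · intro h
      rw [← G.conLift_univ γ] at h
      rcases G.conEnds_conn_aux γ _ h with h | ⟨a, b, ha, hb, h⟩
      · exact ⟨q, edgeConn_refl _, (Quotient.sound h).symm.trans hu⟩
      · refine ⟨b, ?_, hb.symm⟩
        rwa [Subtype.ext (ha.trans hu)] at h
  nonexceptional := by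
    intro S hS hne hc hsum q hq q' hqq' hq'
    obtain ⟨u, hu, hu0⟩ := G.exists_external_of_conMomentum γ (hne q hq)
    obtain ⟨v, hv, hv0⟩ := G.exists_external_of_conMomentum γ hq'
    have := G.nonexceptional
      {v | (∃ q ∈ S, Quotient.mk _ v = q.1) ∧ G.IsExternal v} 
      ⟨u, Finset.mem_filter.2 ⟨Finset.mem_univ _, ⟨q, hq, hu⟩, hu0⟩⟩
      (by intro v hv; simp only [Finset.mem_filter] at hv; exact hv.2.2)
      (by
        intro a ha b hb
        simp only [Finset.mem_filter, Finset.mem_univ, true_and] at ha hb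
        obtain ⟨⟨qa, hqa, ha⟩, -⟩ := ha
        obtain ⟨⟨qb, hqb, hb⟩, -⟩ := hb
        exact (G.conEnds_conn_univ γ ha.symm hb.symm).1 (hc qa hqa qb hqb))
      (by
        rw [← hsum, sum_conMomentum, ← Finset.filter_filter]
        exact sum_filter_external G _)
      u (Finset.mem_filter.2 ⟨Finset.mem_univ _, ⟨q, hq, hu⟩, hu0⟩) v
      ((G.conEnds_conn_univ γ hu.symm hv.symm).1 hqq') hv0
    simp only [Finset.mem_filter, Finset.mem_univ, true_and] at this
    obtain ⟨⟨q'', hq'', h⟩, -⟩ := this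
    rwa [Subtype.ext (hv.symm.trans h)]

theorem contract_loops (c : ℝ) (μ : Finset {e // e ∉ γ}) :
    (G.contract γ c).loops μ = G.loops (G.conLift γ μ) - G.loops γ := by
  let Q := Quotient (edgeConn G.ends γ)
  let p : Q → Prop := fun q => ∃ e, e ∉ γ ∧ q ∈ (G.ends e).map (Quotient.mk _)
  have hcard : (G.conLift γ μ).card = γ.card + μ.card := by
    rw [conLift, Finset.card_union_of_disjoint, Finset.card_map]
    rw [Finset.disjoint_left]
    intro e he h
    obtain ⟨e', -, rfl⟩ := Finset.mem_map.1 h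
    exact e'.2 he
  have h1 : Nat.card Q = Fintype.card (G.ConVert γ) + Nat.card {q : Q // ¬ p q} := by
    rw [← Nat.card_eq_fintype_card, ← Nat.card_sum]
    exact (Nat.card_congr (Equiv.sumCompl p)).symm
  have hle (q q' : Q) (u v : G.V) (hu : Quotient.mk _ u = q) (hv : Quotient.mk _ v = q')
      (hq : ¬ p q) (h : edgeConn G.ends (G.conLift γ μ) u v) : q = q' := by
    rcases G.conEnds_conn_aux γ μ h with h | ⟨a, b, ha, hb, h⟩
    · exact hu.symm.trans ((Quotient.sound h).trans hv)
    · exact absurd (ha.trans hu ▸ a.2) hq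
  have h2 : Nat.card (Quotient (edgeConn G.ends (G.conLift γ μ))) =
      Nat.card (Quotient (edgeConn (G.conEnds γ) μ)) + Nat.card {q : Q // ¬ p q} := by
    rw [← Nat.card_sum]
    symm
    let f : Quotient (edgeConn (G.conEnds γ) μ) ⊕ {q : Q // ¬ p q} →
        Quotient (edgeConn G.ends (G.conLift γ μ)) :=
      Sum.elim (Quotient.map' (fun q => q.1.out) (by
          intro a b h
          exact (G.conEnds_conn γ μ (Quotient.out_eq a.1).symm (Quotient.out_eq b.1).symm).1 h))
        (fun q => Quotient.mk _ q.1.out)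
    refine Nat.card_congr (Equiv.ofBijective f ⟨?_, ?_⟩)
    · rintro (a | a) (b | b) h
      · induction a using Quotient.inductionOn
        induction b using Quotient.inductionOn
        rename_i a b
        have := Quotient.exact h
        exact congrArg Sum.inl (Quotient.sound ((G.conEnds_conn γ μ (Quotient.out_eq a.1).symm
          (Quotient.out_eq b.1).symm).2 this))
      · induction a using Quotient.inductionOn
        rename_i a
        have := Quotient.exact h
        exact absurd (hle b.1 a.1 _ _ (Quotient.out_eq _) (Quotient.out_eq _) b.2
          (edgeConn_symm this) ▸ a.2) b.2
      · induction b using Quotient.inductionOn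
        rename_i b
        have := Quotient.exact h
        exact absurd (hle a.1 b.1 _ _ (Quotient.out_eq _) (Quotient.out_eq _) a.2 this ▸ b.2) a.2
      · have := Quotient.exact h
        exact congrArg Sum.inr (Subtype.ext
          (hle a.1 b.1 _ _ (Quotient.out_eq _) (Quotient.out_eq _) a.2 this))
    · intro x
      induction x using Quotient.inductionOn
      rename_i v
      have hv : edgeConn G.ends (G.conLift γ μ) (Quotient.mk (edgeConn G.ends γ) v).out v :=
        edgeConn_mono (G.subset_conLift γ μ) (Quotient.exact (Quotient.out_eq _))
      by_cases hp : p (Quotient.mk _ v)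
      · exact ⟨.inl (Quotient.mk _ ⟨_, hp⟩), Quotient.sound hv⟩
      · exact ⟨.inr ⟨_, hp⟩, Quotient.sound hv⟩
  have h3 : (G.contract γ c).loops μ = (μ.card : ℤ) - Fintype.card (G.ConVert γ) +
      Nat.card (Quotient (edgeConn (G.conEnds γ) μ)) := by
    unfold loops
    congr!
  rw [h3]
  unfold loops
  rw [hcard, h2]
  have h1' : (Nat.card (Quotient (edgeConn G.ends γ)) : ℤ) = _ := congrArg Nat.cast h1
  rw [h1']
  push_cast
  ring

theorem contract_isMotic (c : ℝ) (hG : G.IsMotic) : (G.contract γ c).IsMotic := by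
  intro μ hμ hmm
  have hne : G.conLift γ μ ≠ Finset.univ := by
    intro h
    apply hμ
    ext ⟨e, he⟩
    have := (G.mem_conLift γ μ he)
    rw [h] at this
    exact iff_of_true (this.1 (Finset.mem_univ _)) (Finset.mem_univ _)
  have hM : G.MM (G.conLift γ μ) := by
    refine ⟨?_, ?_⟩
    · intro e he
      by_cases heγ : e ∈ γ
      · exact G.subset_conLift γ μ heγ
      · exact (G.mem_conLift γ μ heγ).2 (hmm.1 ⟨e, heγ⟩ he)
    · have main (u v : G.V) (hu : G.IsExternal u) (hv : G.IsExternal v)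
          (huv : edgeConn G.ends Finset.univ u v) (a : G.ConVert γ)
          (ha : a.1 = Quotient.mk _ u) (h0 : G.conMomentum γ a = 0) :
          edgeConn G.ends γ u v := by
        have := G.nonexceptional
          {v | Quotient.mk _ v = a.1 ∧ G.IsExternal v} ⟨u, by simp [ha, hu]⟩
          (by intro v hv; simp only [Finset.mem_filter] at hv; exact hv.2.2)
          (by
            intro x hx y hy
            simp only [Finset.mem_filter, Finset.mem_univ, true_and] at hx hy
            exact edgeConn_mono (Finset.subset_univ _) (Quotient.exact (hx.1.trans hy.1.symm)))
          (by
            rw [← h0, conMomentum, ← Finset.filter_filter]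
            exact sum_filter_external G _)
          u (by simp [ha, hu]) v huv hv
        simp only [Finset.mem_filter, Finset.mem_univ, true_and] at this
        exact Quotient.exact (ha.symm.trans this.1.symm)
      intro u v hu hv huv
      have h := huv
      rw [← G.conLift_univ γ] at h
      rcases G.conEnds_conn_aux γ _ h with h | ⟨a, b, ha, hb, h⟩
      · exact edgeConn_mono (G.subset_conLift γ μ) h
      by_cases ha0 : G.conMomentum γ a = 0
      · exact edgeConn_mono (G.subset_conLift γ μ) (main u v hu hv huv a ha ha0)
      by_cases hb0 : G.conMomentum γ b = 0
      · exact edgeConn_symm (edgeConn_mono (G.subset_conLift γ μ)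
          (main v u hv hu (edgeConn_symm huv) b hb hb0))
      exact (G.conEnds_conn γ μ ha hb).1 (hmm.2 a b ha0 hb0 h)
  have h1 := G.contract_loops γ c μ
  have h2 := G.contract_loops γ c Finset.univ
  rw [conLift_univ] at h2
  have := hG _ hne hM
  have h3 : (G.contract γ c).loops Finset.univ = G.loops Finset.univ - G.loops γ := by
    rw [← h2]; congr!
  rw [h1, h3]
  linarith

end contract

/-! ### Isomorphisms -/

/-- Isomorphisms of Feynman graphs: they respect the incidence relation and all labels. -/
structure Iso (G H : FeynmanGraph P) where
  vertexEquiv : G.V ≃ H.V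
  edgeEquiv : G.E ≃ H.E
  ends_eq : ∀ e, H.ends (edgeEquiv e) = (G.ends e).map vertexEquiv
  mass_eq : ∀ e, H.mass (edgeEquiv e) = G.mass e
  edgeWeight_eq : ∀ e, H.edgeWeight (edgeEquiv e) = G.edgeWeight e
  vertexWeight_eq : ∀ v, H.vertexWeight (vertexEquiv v) = G.vertexWeight v
  momentum_eq : ∀ v, H.momentum (vertexEquiv v) = G.momentum v

namespace Iso

variable {G H K : FeynmanGraph P}

def refl (G : FeynmanGraph P) : Iso G G :=
  ⟨Equiv.refl _, Equiv.refl _, fun _ => by simp, fun _ => rfl, fun _ => rfl, fun _ => rfl,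
    fun _ => rfl⟩

def symm (φ : Iso G H) : Iso H G where
  vertexEquiv := φ.vertexEquiv.symm
  edgeEquiv := φ.edgeEquiv.symm
  ends_eq e := by
    obtain ⟨e, rfl⟩ := φ.edgeEquiv.surjective e
    simp [φ.ends_eq, Sym2.map_map]
  mass_eq e := by simp [← φ.mass_eq]
  edgeWeight_eq e := by simp [← φ.edgeWeight_eq]
  vertexWeight_eq v := by simp [← φ.vertexWeight_eq]
  momentum_eq v := by simp [← φ.momentum_eq]

def trans (φ : Iso G H) (ψ : Iso H K) : Iso G K where
  vertexEquiv := φ.vertexEquiv.trans ψ.vertexEquiv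
  edgeEquiv := φ.edgeEquiv.trans ψ.edgeEquiv
  ends_eq e := by simp [φ.ends_eq, ψ.ends_eq, Sym2.map_map]
  mass_eq e := by simp [φ.mass_eq, ψ.mass_eq]
  edgeWeight_eq e := by simp [φ.edgeWeight_eq, ψ.edgeWeight_eq]
  vertexWeight_eq v := by simp [φ.vertexWeight_eq, ψ.vertexWeight_eq]
  momentum_eq v := by simp [φ.momentum_eq, ψ.momentum_eq]

/-- The image of a subgraph. -/
def image (φ : Iso G H) (γ : Finset G.E) : Finset H.E := γ.map φ.edgeEquiv.toEmbedding

theorem mem_image (φ : Iso G H) {γ : Finset G.E} {e : G.E} :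
    φ.edgeEquiv e ∈ φ.image γ ↔ e ∈ γ := by simp [image]

theorem image_univ (φ : Iso G H) : φ.image Finset.univ = Finset.univ := by simp [image]

theorem conn_image (φ : Iso G H) (γ : Finset G.E) (u v : G.V) :
    edgeConn H.ends (φ.image γ) (φ.vertexEquiv u) (φ.vertexEquiv v) ↔ edgeConn G.ends γ u v := by
  constructor
  · intro h
    have := edgeConn_le (r := fun x y => edgeConn G.ends γ (φ.vertexEquiv.symm x)
      (φ.vertexEquiv.symm y)) ⟨fun _ => edgeConn_refl _, fun h => edgeConn_symm h,
        fun h h2 => edgeConn_trans h h2⟩ ?_ h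
    · simpa using this
    · intro e he x y hxy
      obtain ⟨e, rfl⟩ := φ.edgeEquiv.surjective e
      obtain ⟨x, rfl⟩ := φ.vertexEquiv.surjective x
      obtain ⟨y, rfl⟩ := φ.vertexEquiv.surjective y
      rw [φ.ends_eq, ← Sym2.map_mk] at hxy
      simpa using edgeConn_of_edge (φ.mem_image.1 he) (Sym2.map.injective φ.vertexEquiv.injective hxy)
  · refine edgeConn_le (r := fun x y => edgeConn H.ends (φ.image γ) (φ.vertexEquiv x)
      (φ.vertexEquiv y)) ⟨fun _ => edgeConn_refl _, fun h => edgeConn_symm h,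
        fun h h2 => edgeConn_trans h h2⟩ ?_
    intro e he x y hxy
    exact edgeConn_of_edge (φ.mem_image.2 he) (by rw [φ.ends_eq, hxy, Sym2.map_mk])

theorem mem_verts (φ : Iso G H) (γ : Finset G.E) (v : G.V) :
    v ∈ G.verts γ ↔ φ.vertexEquiv v ∈ H.verts (φ.image γ) := by
  simp only [verts, Finset.mem_filter, Finset.mem_univ, true_and]
  rw [← φ.edgeEquiv.exists_congr_right]
  simp only [mem_image, φ.ends_eq, Sym2.mem_map]
  simp

/-- The bijection between the components of a subgraph and those of its image. -/
def quotEquiv (φ : Iso G H) (γ : Finset G.E) :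
    Quotient (edgeConn G.ends γ) ≃ Quotient (edgeConn H.ends (φ.image γ)) :=
  Quotient.congr φ.vertexEquiv (fun u v => (φ.conn_image γ u v).symm)

theorem loops_image (φ : Iso G H) (γ : Finset G.E) : H.loops (φ.image γ) = G.loops γ := by
  simp only [loops]
  rw [Nat.card_congr (φ.quotEquiv γ), Fintype.card_congr φ.vertexEquiv]
  simp [image]

theorem isExternal_iff (φ : Iso G H) (v : G.V) : H.IsExternal (φ.vertexEquiv v) ↔ G.IsExternal v := by
  simp [IsExternal, φ.momentum_eq]

theorem mm_image (φ : Iso G H) (γ : Finset G.E) : H.MM (φ.image γ) ↔ G.MM γ := by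
  simp only [MM, MassSpanning, MomentumSpanning]
  rw [← φ.edgeEquiv.forall_congr_right, ← φ.vertexEquiv.forall_congr_right]
  simp only [← φ.vertexEquiv.forall_congr_right (q := fun v => H.IsExternal _ → _ → _ → _)]
  simp only [φ.mass_eq, mem_image, isExternal_iff, conn_image]
  rw [← φ.image_univ]
  simp only [conn_image]

theorem isMotic_aux (φ : Iso G H) (h : G.IsMotic) : H.IsMotic := by
  intro μ hμ hm
  have e : φ.image (φ.symm.image μ) = μ := by
    ext x
    obtain ⟨x, rfl⟩ := φ.edgeEquiv.surjective x
    rw [mem_image]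
    conv_rhs => rw [← φ.symm.mem_image]
    simp [symm]
  rw [← e, φ.mm_image] at hm
  rw [← e, φ.loops_image, ← φ.image_univ, φ.loops_image]
  refine h _ ?_ hm
  intro h'
  rw [h', φ.image_univ] at e
  exact hμ e.symm

/-- An isomorphism restricts to subgraphs. -/
def sub (φ : Iso G H) (γ : Finset G.E) : Iso (G.sub γ) (H.sub (φ.image γ)) where
  vertexEquiv := φ.vertexEquiv.subtypeEquiv (φ.mem_verts γ)
  edgeEquiv := φ.edgeEquiv.subtypeEquiv (fun _ => φ.mem_image.symm)
  ends_eq e := by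
    apply Sym2.map.injective Subtype.val_injective
    refine (H.subEnds_map _ _).trans ((φ.ends_eq e.1).trans ?_)
    rw [← G.subEnds_map γ e, Sym2.map_map]
    change _ = Sym2.map _ (Sym2.map _ (G.subEnds γ e))
    generalize G.subEnds γ e = x
    induction x using Sym2.ind
    rfl
  mass_eq e := by simp only [FeynmanGraph.sub, φ.mm_image]; exact congrArg (ite _ · 0) (φ.mass_eq e.1)
  edgeWeight_eq e := φ.edgeWeight_eq e.1
  vertexWeight_eq v := φ.vertexWeight_eq v.1
  momentum_eq v := by
    simp only [FeynmanGraph.sub, φ.mm_image]; exact congrArg (ite _ · 0) (φ.momentum_eq v.1)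

/-- An isomorphism induces isomorphisms of contractions. -/
def contract (φ : Iso G H) (γ : Finset G.E) (c : ℝ) :
    Iso (G.contract γ c) (H.contract (φ.image γ) c) where
  vertexEquiv := (φ.quotEquiv γ).subtypeEquiv (fun q => by
    rw [← φ.edgeEquiv.exists_congr_right]
    simp only [mem_image, φ.ends_eq, Sym2.map_map]
    have : ∀ e, (G.ends e).map (Quotient.mk _ ∘ φ.vertexEquiv) =
        ((G.ends e).map (Quotient.mk _)).map (φ.quotEquiv γ) := by
      intro e; rw [Sym2.map_map]; rfl
    simp only [this, Sym2.mem_map (f := φ.quotEquiv γ)]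
    simp)
  edgeEquiv := φ.edgeEquiv.subtypeEquiv (fun _ => not_congr φ.mem_image.symm)
  ends_eq e := by
    apply Sym2.map.injective Subtype.val_injective
    refine (H.conEnds_map _ _).trans ((congrArg _ (φ.ends_eq e.1)).trans ?_)
    have h := G.conEnds_map γ e
    rw [Sym2.map_map]
    have : (G.ends e.1).map (Quotient.mk _ ∘ φ.vertexEquiv) =
        ((G.ends e.1).map (Quotient.mk _)).map (φ.quotEquiv γ) := by
      rw [Sym2.map_map]; rfl
    refine this.trans ?_
    rw [← h, Sym2.map_map]
    change _ = Sym2.map _ (Sym2.map _ (G.conEnds γ e))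
    generalize G.conEnds γ e = x
    induction x using Sym2.ind
    rfl
  mass_eq e := φ.mass_eq e.1
  edgeWeight_eq e := φ.edgeWeight_eq e.1
  vertexWeight_eq q := by
    have hq (v : G.V) : Quotient.mk (edgeConn H.ends (φ.image γ)) (φ.vertexEquiv v) =
        φ.quotEquiv γ q.1 ↔ Quotient.mk _ v = q.1 :=
      (φ.quotEquiv γ).injective.eq_iff (a := Quotient.mk _ v)
    have h1 : (∃ v ∈ H.verts (φ.image γ), Quotient.mk _ v = φ.quotEquiv γ q.1) ↔
        ∃ v ∈ G.verts γ, Quotient.mk _ v = q.1 := by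
      rw [← φ.vertexEquiv.exists_congr_right]
      simp only [← φ.mem_verts, hq]
    have h2 : ∑ v with Quotient.mk _ v = φ.quotEquiv γ q.1, H.vertexWeight v =
        ∑ v with Quotient.mk _ v = q.1, G.vertexWeight v := by
      simp only [Finset.sum_filter]
      rw [← φ.vertexEquiv.sum_comp]
      simp only [hq, φ.vertexWeight_eq]
    simp only [FeynmanGraph.contract]
    exact if_congr h1 rfl h2
  momentum_eq q := by
    have hq (v : G.V) : Quotient.mk (edgeConn H.ends (φ.image γ)) (φ.vertexEquiv v) =
        φ.quotEquiv γ q.1 ↔ Quotient.mk _ v = q.1 :=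
      (φ.quotEquiv γ).injective.eq_iff (a := Quotient.mk _ v)
    change ∑ v with Quotient.mk _ v = φ.quotEquiv γ q.1, H.momentum v =
        ∑ v with Quotient.mk _ v = q.1, G.momentum v
    simp only [Finset.sum_filter]
    rw [← φ.vertexEquiv.sum_comp]
    simp only [hq, φ.momentum_eq]

end Iso

/-! ### Power counting, divergent graphs -/

/-- The superficial degree of divergence, in dimension `D`, of the subgraph with edge set `δ`. -/
noncomputable def omega (D : ℝ) (G : FeynmanGraph P) (δ : Finset G.E) : ℝ :=
  D * G.loops δ + ∑ v ∈ G.verts δ, G.vertexWeight v - ∑ e ∈ δ, G.edgeWeight e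

/-- The edge sets of the connected components. -/
def components (G : FeynmanGraph P) : Set (Finset G.E) :=
  Set.range fun u : G.V => ({e | ∀ v ∈ G.ends e, edgeConn G.ends Finset.univ u v} : Finset G.E)

/-- One-particle irreducible: connected, also after the removal of any one edge. -/
def IsOnePI (G : FeynmanGraph P) (δ : Finset G.E) : Prop :=
  (∀ u ∈ G.verts δ, ∀ v ∈ G.verts δ, edgeConn G.ends δ u v) ∧
    ∀ e ∈ δ, ∀ u ∈ G.verts δ, ∀ v ∈ G.verts δ, edgeConn G.ends (δ.erase e) u v

/-- Biconnected (nonseparable): a nonempty subgraph that is not the union of two nonempty subgraphs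
without common edges which share at most one vertex. A self-loop is separable from all other edges. -/
def IsBiconnected (G : FeynmanGraph P) (δ : Finset G.E) : Prop :=
  δ.Nonempty ∧ ∀ α β : Finset G.E, α.Nonempty → β.Nonempty → Disjoint α β → α ∪ β = δ →
    2 ≤ (G.verts α ∩ G.verts β).card

/-- The edge sets of the biconnected components, that is, the maximal biconnected subgraphs. -/
def blocks (G : FeynmanGraph P) : Set (Finset G.E) :=
  {δ | Maximal G.IsBiconnected δ}

/-- The two decompositions of a scaleless graph into pieces that are subject to infrared power
counting. -/
inductive PieceKind
  | connected
  | biconnected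

/-- The pieces of a graph: its connected components or its biconnected components. -/
def pieces (G : FeynmanGraph P) : PieceKind → Set (Finset G.E)
  | .connected => G.components
  | .biconnected => G.blocks

/-- Every connected component is 1PI and superficially UV divergent. -/
def UVDivergent (D : ℝ) (G : FeynmanGraph P) : Prop :=
  ∀ δ ∈ G.components, G.IsOnePI δ ∧ 0 ≤ G.omega D δ

/-- Scaleless, and every piece is superficially IR divergent. -/
def IRDivergent (D : ℝ) (k : PieceKind) (G : FeynmanGraph P) : Prop :=
  G.Scaleless ∧ ∀ δ ∈ G.pieces k, G.omega D δ ≤ 0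

end FeynmanGraph

/-! ## The space of motic graphs and its coproduct -/

def MoticGraph (P : Type*) [AddCommGroup P] := {G : FeynmanGraph P // G.IsMotic}

instance moticSetoid (P : Type*) [AddCommGroup P] : Setoid (MoticGraph P) where
  r G H := Nonempty (G.1.Iso H.1)
  iseqv := ⟨fun G => ⟨.refl G.1⟩, fun ⟨φ⟩ => ⟨φ.symm⟩, fun ⟨φ⟩ ⟨ψ⟩ => ⟨φ.trans ψ⟩⟩

/-- Isomorphism classes of motic graphs. -/
abbrev MoticClass (P : Type*) [AddCommGroup P] := Quotient (moticSetoid P)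

/-- The rational vector space `M` with the isomorphism classes of motic graphs as a basis. -/
abbrev MoticSpace (P : Type*) [AddCommGroup P] := MoticClass P →₀ ℚ

namespace MoticSpace

variable {P : Type*} [AddCommGroup P]

/-- The basis element of a motic graph. -/
noncomputable def of (G : FeynmanGraph P) (hG : G.IsMotic) : MoticSpace P :=
  Finsupp.single (Quotient.mk _ ⟨G, hG⟩) 1

theorem of_eq {G H : FeynmanGraph P} (hG : G.IsMotic) (hH : H.IsMotic) (φ : G.Iso H) :
    of G hG = of H hH :=
  congrArg (Finsupp.single · 1) (Quotient.sound ⟨φ⟩)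

/-- The coproduct of a motic graph: the sum of `γ ⊗ G / γ` over all motic subgraphs `γ` of `G`. -/
noncomputable def coproductGraph (c : ℝ) (G : MoticGraph P) : MoticSpace P ⊗[ℚ] MoticSpace P :=
  ∑ γ : {γ : Finset G.1.E // (G.1.sub γ).IsMotic},
    of (G.1.sub γ) γ.2 ⊗ₜ[ℚ] of (G.1.contract γ c) (G.1.contract_isMotic γ c G.2)

theorem coproductGraph_eq (c : ℝ) (G H : MoticGraph P) (h : G ≈ H) :
    coproductGraph c G = coproductGraph c H := by
  obtain ⟨φ⟩ := h
  refine Fintype.sum_equiv (φ.edgeEquiv.finsetCongr.subtypeEquiv fun γ => ?_) _ _ fun γ => ?_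
  · exact ⟨(φ.sub γ).isMotic_aux, (φ.sub γ).symm.isMotic_aux⟩
  · exact congrArg₂ (· ⊗ₜ[ℚ] ·) (of_eq _ _ (φ.sub γ.1)) (of_eq _ _ (φ.contract γ.1 c))

/-- The motic coproduct `Δ : M → M ⊗ M`. The vertices that arise by contraction have weight `c`. -/
noncomputable def coproduct (c : ℝ) : MoticSpace P →ₗ[ℚ] MoticSpace P ⊗[ℚ] MoticSpace P :=
  Finsupp.linearCombination ℚ (Quotient.lift (coproductGraph c) (coproductGraph_eq c))

/-- The double coproduct `Δ⁽²⁾ = (Δ ⊗ id) ∘ Δ : M → M ⊗ (M ⊗ M)`. -/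
noncomputable def doubleCoproduct (c : ℝ) :
    MoticSpace P →ₗ[ℚ] MoticSpace P ⊗[ℚ] (MoticSpace P ⊗[ℚ] MoticSpace P) :=
  (TensorProduct.assoc ℚ _ _ _).toLinearMap ∘ₗ (coproduct c).rTensor _ ∘ₗ coproduct c

/-- The classes of divergent UV-graphs. -/
def uvClasses (P : Type*) [AddCommGroup P] (D : ℝ) : Set (MoticClass P) :=
  {x | ∃ G : MoticGraph P, Quotient.mk _ G = x ∧ G.1.UVDivergent D}

/-- The classes of scaleless, piecewise superficially IR divergent graphs. -/
def irClasses (P : Type*) [AddCommGroup P] (D : ℝ) (k : FeynmanGraph.PieceKind) :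
    Set (MoticClass P) :=
  {x | ∃ G : MoticGraph P, Quotient.mk _ G = x ∧ G.1.IRDivergent D k}

/-- The subspace of `M` spanned by the divergent UV-graphs. -/
abbrev HUV (P : Type*) [AddCommGroup P] (D : ℝ) : Submodule ℚ (MoticSpace P) :=
  Finsupp.supported ℚ ℚ (uvClasses P D)

/-- The subspace of `M` spanned by the scaleless, piecewise superficially IR divergent graphs. -/
abbrev HIR (P : Type*) [AddCommGroup P] (D : ℝ) (k : FeynmanGraph.PieceKind) :
    Submodule ℚ (MoticSpace P) :=
  Finsupp.supported ℚ ℚ (irClasses P D k)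

/-- The projection to `HUV` that kills all motic graphs which are not divergent UV-graphs. -/
noncomputable def rhoUV (D : ℝ) : MoticSpace P →ₗ[ℚ] HUV P D :=
  Finsupp.restrictDom ℚ ℚ (uvClasses P D)

/-- The projection to `HIR` that kills all motic graphs which do not span it. -/
noncomputable def rhoIR (D : ℝ) (k : FeynmanGraph.PieceKind) : MoticSpace P →ₗ[ℚ] HIR P D k :=
  Finsupp.restrictDom ℚ ℚ (irClasses P D k)

/-- The UV coaction `(ρ_UV ⊗ id) ∘ Δ`. -/
noncomputable def coactionUV (D c : ℝ) : MoticSpace P →ₗ[ℚ] HUV P D ⊗[ℚ] MoticSpace P :=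
  (rhoUV D).rTensor _ ∘ₗ coproduct c

/-- The IR coaction `(id ⊗ ρ_IR) ∘ Δ`. -/
noncomputable def coactionIR (D c : ℝ) (k : FeynmanGraph.PieceKind) :
    MoticSpace P →ₗ[ℚ] MoticSpace P ⊗[ℚ] HIR P D k :=
  (rhoIR D k).lTensor _ ∘ₗ coproduct c

end MoticSpace

/-! The projections `rhoUV` and `rhoIR` act on the outer tensor factors only and commute with a
coproduct applied in another factor. This holds for any linear maps in their place, so no property
of divergent graphs enters and both readings of "pieces" are covered. Everything reduces to the
coassociativity of the motic coproduct, `coproduct_coassoc`.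

Both iterated coproducts of `Γ` are sums of `δ ⊗ γ/δ ⊗ Γ/γ` over chains `δ ⊆ γ ⊆ Γ`. In one, `γ` is
motic in `Γ` and `δ` is motic in `γ`; in the other, `δ` is motic in `Γ` and `γ/δ` is motic in `Γ/δ`.
The tensor factors agree by `subSubIso`, `subContractIso` and `contractContractIso`. The masses and
momenta match because being mass-momentum-spanning is transitive (`sub_mm_iff`) and is unaffected by
contraction (`contract_mm_iff`); the latter rests on non-exceptionality.

The index sets agree by `isMotic_conLift_iff`: for `δ` motic, `γ` is motic iff `γ/δ` is. Moticity is
a condition on single edges: if deleting `e` preserves the mm property, then the rest joins the ends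
of `e`. For `e` outside `δ` the conditions in `γ` and in `γ/δ` coincide. For `e` in `δ`, either the
condition on `δ` already yields the connection, or deleting `e` destroys the mm property of `δ` but
not that of `γ`. Then `e` is massless and separates two external vertices in `δ` that remain joined
in `γ` without `e`, so `e` lies on a loop of `γ`. -/

section conn
-- Connectivity and the number of components when an edge is added
variable {V E : Type} {ends : E → Sym2 V}

/-- A path can be shortened until it crosses `e` at most once, in one of two directions. In the
proof this is the transitivity of the relation on the right. -/
theorem edgeConn_insert_iff {γ : Finset E} {e : E} {a b : V} (he : ends e = s(a, b)) {u v : V} :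
    edgeConn ends (insert e γ) u v ↔ edgeConn ends γ u v ∨
      (edgeConn ends γ u a ∧ edgeConn ends γ b v) ∨ (edgeConn ends γ u b ∧ edgeConn ends γ a v) := by
  have hmono {x y : V} (h : edgeConn ends γ x y) : edgeConn ends (insert e γ) x y :=
    edgeConn_mono (Finset.subset_insert _ _) h
  have hab : edgeConn ends (insert e γ) a b := edgeConn_of_edge (Finset.mem_insert_self _ _) he
  constructor
  · refine edgeConn_le (r := fun u v => edgeConn ends γ u v ∨
      (edgeConn ends γ u a ∧ edgeConn ends γ b v) ∨ (edgeConn ends γ u b ∧ edgeConn ends γ a v))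
      ⟨fun _ => .inl (edgeConn_refl _), ?_, ?_⟩ ?_
    · rintro x y (h | ⟨h, h'⟩ | ⟨h, h'⟩)
      · exact .inl (edgeConn_symm h)
      · exact .inr (.inr ⟨edgeConn_symm h', edgeConn_symm h⟩)
      · exact .inr (.inl ⟨edgeConn_symm h', edgeConn_symm h⟩)
    · rintro x y z (h | ⟨h, h'⟩ | ⟨h, h'⟩) (k | ⟨k, k'⟩ | ⟨k, k'⟩)
      · exact .inl (edgeConn_trans h k)
      · exact .inr (.inl ⟨edgeConn_trans h k, k'⟩)
      · exact .inr (.inr ⟨edgeConn_trans h k, k'⟩)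
      · exact .inr (.inl ⟨h, edgeConn_trans h' k⟩)
      · exact .inr (.inl ⟨h, k'⟩)
      · exact .inl (edgeConn_trans h k')
      · exact .inr (.inr ⟨h, edgeConn_trans h' k⟩)
      · exact .inl (edgeConn_trans h k')
      · exact .inr (.inr ⟨h, k'⟩)
    · intro f hf x y hxy
      rcases Finset.mem_insert.1 hf with rfl | hf
      · rcases Sym2.eq_iff.1 (he.symm.trans hxy) with ⟨rfl, rfl⟩ | ⟨rfl, rfl⟩
        · exact .inr (.inl ⟨edgeConn_refl _, edgeConn_refl _⟩)
        · exact .inr (.inr ⟨edgeConn_refl _, edgeConn_refl _⟩)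
      · exact .inl (edgeConn_of_edge hf hxy)
  · rintro (h | ⟨h, h'⟩ | ⟨h, h'⟩)
    · exact hmono h
    · exact edgeConn_trans (hmono h) (edgeConn_trans hab (hmono h'))
    · exact edgeConn_trans (hmono h) (edgeConn_trans (edgeConn_symm hab) (hmono h'))

/-- The ends of `e` are joined by edges from `γ`. -/
def EndsConn (ends : E → Sym2 V) (γ : Finset E) (e : E) : Prop :=
  ∀ u ∈ ends e, ∀ v ∈ ends e, edgeConn ends γ u v

theorem EndsConn.mono {γ δ : Finset E} (h : γ ⊆ δ) {e : E} (he : EndsConn ends γ e) :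
    EndsConn ends δ e := fun u hu v hv => edgeConn_mono h (he u hu v hv)

theorem endsConn_iff {γ : Finset E} {e : E} {a b : V} (he : ends e = s(a, b)) :
    EndsConn ends γ e ↔ edgeConn ends γ a b := by
  refine ⟨fun h => h a (by simp [he]) b (by simp [he]), fun h u hu v hv => ?_⟩
  rw [he, Sym2.mem_iff] at hu hv
  rcases hu with rfl | rfl <;> rcases hv with rfl | rfl
  · exact edgeConn_refl _
  · exact h
  · exact edgeConn_symm h
  · exact edgeConn_refl _

/-- If two vertices are connected in `δ` but no longer without the edge `e`, then any connection
between them that avoids `e` joins, together with `δ`, the ends of `e`. -/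
theorem endsConn_of_separating {γ δ : Finset E} {e : E} (hδγ : δ.erase e ⊆ γ) {u v : V}
    (h : edgeConn ends δ u v) (h' : ¬ edgeConn ends (δ.erase e) u v) (hγ : edgeConn ends γ u v) :
    EndsConn ends γ e := by
  obtain ⟨a, b, he⟩ : ∃ a b, ends e = s(a, b) := by
    induction h : ends e using Sym2.ind with | _ a b => exact ⟨a, b, rfl⟩
  rw [endsConn_iff he]
  have h1 := edgeConn_mono (Finset.insert_erase_subset e δ : _) h
  rcases (edgeConn_insert_iff he).1 h1 with h | ⟨h, k⟩ | ⟨h, k⟩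
  -- The path in `δ` must cross `e`. Its two halves avoid `e` and so lie in `γ`; together with the
  -- connection from `u` to `v` in `γ` they join the ends of `e`.
  · exact absurd h h'
  · exact edgeConn_trans (edgeConn_symm (edgeConn_mono hδγ h))
      (edgeConn_trans hγ (edgeConn_symm (edgeConn_mono hδγ k)))
  · exact edgeConn_trans (edgeConn_mono hδγ k)
      (edgeConn_trans (edgeConn_symm hγ) (edgeConn_mono hδγ h))

theorem card_components_insert_of_endsConn [Finite V] {γ : Finset E} {e : E}
    (h : EndsConn ends γ e) :
    Nat.card (Quotient (edgeConn ends (insert e γ))) = Nat.card (Quotient (edgeConn ends γ)) := by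
  obtain ⟨a, b, he⟩ : ∃ a b, ends e = s(a, b) := by
    induction h : ends e using Sym2.ind with | _ a b => exact ⟨a, b, rfl⟩
  rw [endsConn_iff he] at h
  refine Nat.card_congr (Quotient.congrRight fun u v => ?_)
  rw [edgeConn_insert_iff he]
  refine ⟨?_, .inl⟩
  rintro (k | ⟨k, k'⟩ | ⟨k, k'⟩)
  · exact k
  · exact edgeConn_trans k (edgeConn_trans h k')
  · exact edgeConn_trans k (edgeConn_trans (edgeConn_symm h) k')

/-- The map from old to new components is surjective. With equal cardinalities it would be
injective, but it identifies the classes of the two ends of `e`. -/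
theorem card_components_insert_lt [Finite V] {γ : Finset E} {e : E}
    (h : ¬ EndsConn ends γ e) :
    Nat.card (Quotient (edgeConn ends (insert e γ))) < Nat.card (Quotient (edgeConn ends γ)) := by
  obtain ⟨a, b, he⟩ : ∃ a b, ends e = s(a, b) := by
    induction h : ends e using Sym2.ind with | _ a b => exact ⟨a, b, rfl⟩
  rw [endsConn_iff he] at h
  let f : Quotient (edgeConn ends γ) → Quotient (edgeConn ends (insert e γ)) :=
    Quotient.map' id fun _ _ h => edgeConn_mono (Finset.subset_insert _ _) h
  have hf : Function.Surjective f := by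
    intro q
    induction q using Quotient.inductionOn with | _ v => exact ⟨Quotient.mk _ v, rfl⟩
  refine lt_of_le_of_ne (Nat.card_le_card_of_surjective f hf) fun hc => h ?_
  have hi := ((Nat.bijective_iff_surjective_and_card f).2 ⟨hf, hc.symm⟩).1
  exact Quotient.exact (hi (a₁ := Quotient.mk _ a) (a₂ := Quotient.mk _ b) (Quotient.sound
    (edgeConn_of_edge (Finset.mem_insert_self _ _) he)))

theorem card_components_le_insert [Finite V] (γ : Finset E) (e : E) :
    Nat.card (Quotient (edgeConn ends γ)) ≤
      Nat.card (Quotient (edgeConn ends (insert e γ))) + 1 := by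
  obtain ⟨a, b, he⟩ : ∃ a b, ends e = s(a, b) := by
    induction h : ends e using Sym2.ind with | _ a b => exact ⟨a, b, rfl⟩
  let f : Quotient (edgeConn ends γ) → Quotient (edgeConn ends (insert e γ)) :=
    Quotient.map' id fun _ _ h => edgeConn_mono (Finset.subset_insert _ _) h
  have hcard := Finite.card_option (α := Quotient (edgeConn ends (insert e γ)))
  rw [← hcard]
  -- Only the classes of `a` and `b` can merge. Sending that of `a` to the extra point `none`
  -- therefore makes the map injective.
  refine Nat.card_le_card_of_injective
    (fun q => if q = Quotient.mk _ a then none else some (f q)) fun p q hpq => ?_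
  dsimp only at hpq
  split_ifs at hpq with hp hq hq
  · exact hp.trans hq.symm
  · induction p using Quotient.inductionOn with | _ u =>
    induction q using Quotient.inductionOn with | _ v =>
    have h : edgeConn ends (insert e γ) u v := Quotient.exact (Option.some.inj hpq)
    rcases (edgeConn_insert_iff he).1 h with k | ⟨k, -⟩ | ⟨-, k⟩
    · exact Quotient.sound k
    · exact absurd (Quotient.sound k) hp
    · exact absurd (Quotient.sound (edgeConn_symm k)) hq

end conn

/-! ### Loop numbers and the edgewise criterion for motic graphs -/

namespace FeynmanGraph
variable {P : Type*} [AddCommGroup P] (G : FeynmanGraph P)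

/-- A new edge raises the edge count by one and lowers the number of components by at most one. -/
theorem loops_le_insert (γ : Finset G.E) (e : G.E) : G.loops γ ≤ G.loops (insert e γ) := by
  by_cases he : e ∈ γ
  · rw [Finset.insert_eq_of_mem he]
  · have := card_components_le_insert (ends := G.ends) γ e
    simp only [loops, Finset.card_insert_of_notMem he]
    omega

theorem loops_mono {γ δ : Finset G.E} (h : γ ⊆ δ) : G.loops γ ≤ G.loops δ := by
  obtain ⟨η, rfl⟩ : ∃ η, δ = η ∪ γ := ⟨δ, (Finset.union_eq_left.2 h).symm⟩
  clear h
  induction η using Finset.induction_on with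
  | empty => simp
  | insert e η _ ih =>
    rw [Finset.insert_union]
    exact ih.trans (G.loops_le_insert _ e)

/-- A new edge either closes a loop or merges two components, according to whether its ends were
already joined. -/
theorem loops_lt_insert_iff {γ : Finset G.E} {e : G.E} (he : e ∉ γ) :
    G.loops γ < G.loops (insert e γ) ↔ EndsConn G.ends γ e := by
  by_cases h : EndsConn G.ends γ e
  · have := card_components_insert_of_endsConn h
    simp only [loops, Finset.card_insert_of_notMem he, h, iff_true, this]
    push_cast
    linarith
  · have := card_components_insert_lt h
    simp only [loops, Finset.card_insert_of_notMem he, h, iff_false]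
    omega

variable {G} in
theorem MM.mono {γ δ : Finset G.E} (h : γ ⊆ δ) (hγ : G.MM γ) : G.MM δ :=
  ⟨fun e he => h (hγ.1 e he), fun u v hu hv huv => edgeConn_mono h (hγ.2 u v hu hv huv)⟩

/-- A graph is motic if no edge can be removed without losing a loop or the property of being
mass-momentum-spanning. -/
theorem isMotic_iff :
    G.IsMotic ↔ ∀ e, G.MM (Finset.univ.erase e) → EndsConn G.ends (Finset.univ.erase e) e := by
  have key (e : G.E) : G.loops (Finset.univ.erase e) < G.loops Finset.univ ↔
      EndsConn G.ends (Finset.univ.erase e) e := by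
    rw [← G.loops_lt_insert_iff (Finset.notMem_erase _ _),
      Finset.insert_erase (Finset.mem_univ e)]
  constructor
  · intro h e he
    exact (key e).1 (h _ (Finset.erase_ne_self.2 (Finset.mem_univ e)) he)
  · intro h μ hμ hm
    -- `MM` and `loops` are both monotone, so the maximal proper subgraphs `univ.erase e` decide.
    obtain ⟨e, he⟩ : ∃ e, e ∉ μ := by
      by_contra! h
      exact hμ (Finset.eq_univ_of_forall h)
    have hle : μ ⊆ Finset.univ.erase e := fun x hx =>
      Finset.mem_erase.2 ⟨fun h => he (h ▸ hx), Finset.mem_univ _⟩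
    exact (G.loops_mono hle).trans_lt ((key e).2 (h e (hm.mono hle)))

end FeynmanGraph

/-! ### Spanning and motic subgraphs, expressed in the ambient graph -/

namespace FeynmanGraph
variable {P : Type*} [AddCommGroup P] (G : FeynmanGraph P) (γ : Finset G.E)

theorem mem_verts {v : G.V} : v ∈ G.verts γ ↔ ∃ e ∈ γ, v ∈ G.ends e := by simp [verts]

variable {G} in
theorem verts_mono {γ δ : Finset G.E} (h : γ ⊆ δ) : G.verts γ ⊆ G.verts δ := by
  intro v hv
  obtain ⟨e, he, hv⟩ := (G.mem_verts _).1 hv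
  exact (G.mem_verts _).2 ⟨e, h he, hv⟩

/-- The edges in `G` of a subgraph of a subgraph. -/
def subLift (δ : Finset {e // e ∈ γ}) : Finset G.E := δ.map (Function.Embedding.subtype _)

theorem mem_subLift (δ : Finset {e // e ∈ γ}) {e : G.E} (he : e ∈ γ) :
    e ∈ G.subLift γ δ ↔ ⟨e, he⟩ ∈ δ := by
  simp [subLift, he]

theorem subLift_subset (δ : Finset {e // e ∈ γ}) : G.subLift γ δ ⊆ γ := by
  intro e he
  obtain ⟨e, -, rfl⟩ := Finset.mem_map.1 he
  exact e.2

theorem mem_subEnds {e : {e // e ∈ γ}} {v : {v // v ∈ G.verts γ}} :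
    v ∈ G.subEnds γ e ↔ v.1 ∈ G.ends e := by
  rw [← G.subEnds_map γ e, Sym2.mem_map]
  simp

theorem mem_verts_sub (δ : Finset {e // e ∈ γ}) (v : {v // v ∈ G.verts γ}) :
    v ∈ (G.sub γ).verts δ ↔ v.1 ∈ G.verts (G.subLift γ δ) := by
  refine ((G.sub γ).mem_verts _).trans (Iff.trans ?_ (G.mem_verts _).symm)
  constructor
  · rintro ⟨e, he, hv⟩
    exact ⟨e.1, (G.mem_subLift γ δ e.2).2 he, (G.mem_subEnds γ).1 hv⟩
  · rintro ⟨e, he, hv⟩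
    have h := G.subLift_subset γ δ he
    exact ⟨⟨e, h⟩, (G.mem_subLift γ δ h).1 he, (G.mem_subEnds γ).2 hv⟩

theorem subEnds_conn_iff (δ : Finset {e // e ∈ γ}) (u v : {v // v ∈ G.verts γ}) :
    edgeConn (G.subEnds γ) δ u v ↔ edgeConn G.ends (G.subLift γ δ) u.1 v.1 := by
  constructor
  · refine edgeConn_le (r := fun u v : {v // v ∈ G.verts γ} =>
      edgeConn G.ends (G.subLift γ δ) u.1 v.1)
      ⟨fun _ => edgeConn_refl _, fun h => edgeConn_symm h, fun h h2 => edgeConn_trans h h2⟩ ?_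
    intro e he u v h
    have := G.subEnds_map γ e
    rw [h, Sym2.map_mk] at this
    exact edgeConn_of_edge ((G.mem_subLift γ δ e.2).2 he) this.symm
  · intro h
    have key : u.1 = v.1 ∨ ∃ a b : {v // v ∈ G.verts γ}, a.1 = u.1 ∧ b.1 = v.1 ∧
        edgeConn (G.subEnds γ) δ a b := by
      -- The induction runs over all vertices of `G`. Those outside `γ` are related only to
      -- themselves, hence the alternative `x = y`.
      refine edgeConn_le (r := fun x y => x = y ∨ ∃ a b : {v // v ∈ G.verts γ}, a.1 = x ∧
        b.1 = y ∧ edgeConn (G.subEnds γ) δ a b) ⟨fun _ => .inl rfl, ?_, ?_⟩ ?_ h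
      · rintro x y (h | ⟨a, b, ha, hb, h⟩)
        · exact .inl h.symm
        · exact .inr ⟨b, a, hb, ha, edgeConn_symm h⟩
      · rintro x y z (rfl | ⟨a, b, ha, hb, h⟩) h2
        · exact h2
        · rcases h2 with rfl | ⟨a', b', ha', hb', h'⟩
          · exact .inr ⟨a, b, ha, hb, h⟩
          · have : b = a' := Subtype.ext (hb.trans ha'.symm)
            subst this
            exact .inr ⟨a, b', ha, hb', edgeConn_trans h h'⟩
      · intro e he x y hxy
        have hγ := G.subLift_subset γ δ he
        refine .inr ⟨⟨x, (G.mem_verts _).2 ⟨e, hγ, by simp [hxy]⟩⟩,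
          ⟨y, (G.mem_verts _).2 ⟨e, hγ, by simp [hxy]⟩⟩, rfl, rfl,
          edgeConn_of_edge ((G.mem_subLift γ δ hγ).1 he) ?_⟩
        apply Sym2.map.injective Subtype.val_injective
        exact (G.subEnds_map γ ⟨e, hγ⟩).trans hxy
    rcases key with h | ⟨a, b, ha, hb, h⟩
    · rw [Subtype.ext h]
    · rwa [Subtype.ext ha, Subtype.ext hb] at h

theorem endsConn_sub_iff (δ : Finset {e // e ∈ γ}) (e : {e // e ∈ γ}) :
    EndsConn (G.subEnds γ) δ e ↔ EndsConn G.ends (G.subLift γ δ) e.1 := by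
  have hv {v : G.V} (h : v ∈ G.ends e.1) : v ∈ G.verts γ := (G.mem_verts _).2 ⟨_, e.2, h⟩
  constructor
  · intro h u hu v hv'
    exact (G.subEnds_conn_iff γ δ ⟨u, hv hu⟩ ⟨v, hv hv'⟩).1
      (h _ ((G.mem_subEnds γ).2 hu) _ ((G.mem_subEnds γ).2 hv'))
  · intro h u hu v hv
    exact (G.subEnds_conn_iff γ δ u v).2
      (h _ ((G.mem_subEnds γ).1 hu) _ ((G.mem_subEnds γ).1 hv))

/-- An mm subgraph `γ` inherits all scales and keeps the external vertices of each component of `G`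
together, so spanning in `γ` and in `G` mean the same. Otherwise `γ` is scaleless and each of its
subgraphs spans, which is the vacuous implication. -/
theorem sub_mm_iff (δ : Finset {e // e ∈ γ}) :
    (G.sub γ).MM δ ↔ (G.MM γ → G.MM (G.subLift γ δ)) := by
  by_cases hm : G.MM γ
  · simp only [hm, true_imp_iff]
    constructor
    · rintro ⟨h1, h2⟩
      refine ⟨fun e he => ?_, fun u v hu hv huv => ?_⟩
      · exact (G.mem_subLift γ δ (hm.1 e he)).2 (h1 ⟨e, hm.1 e he⟩ (by simpa [sub, hm] using he))
      -- By momentum conservation an external vertex is never alone in its component. Hence `γ`,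
      -- which joins it to another one, has it as an end point.
      · have hu' := G.mem_verts_of_external γ hm hu
        have hv' := G.mem_verts_of_external γ hm hv
        exact (G.subEnds_conn_iff γ δ ⟨u, hu'⟩ ⟨v, hv'⟩).1 (h2 ⟨u, hu'⟩ ⟨v, hv'⟩
          (by simpa [sub, hm, IsExternal] using hu) (by simpa [sub, hm, IsExternal] using hv)
          ((G.subEnds_conn γ _ _).2 (hm.2 u v hu hv huv)))
    · rintro ⟨h1, h2⟩
      refine ⟨fun e he => ?_, fun u v hu hv huv => ?_⟩
      · exact (G.mem_subLift γ δ e.2).1 (h1 e.1 (by simpa [sub, hm] using he))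
      · exact (G.subEnds_conn_iff γ δ u v).2 (h2 u.1 v.1
          (by simpa [sub, hm, IsExternal] using hu) (by simpa [sub, hm, IsExternal] using hv)
          (edgeConn_mono (Finset.subset_univ _) ((G.subEnds_conn γ _ _).1 huv)))
  · simp only [hm, false_imp_iff, iff_true]
    exact ⟨fun e he => absurd (if_neg hm) he, fun u v hu => absurd (if_neg hm) hu⟩

/-- The edgewise criterion with all data read off in `G`. Subgraphs of `γ` and of `G / δ` can then
be compared without handling nested subtypes. -/
theorem sub_isMotic_iff : (G.sub γ).IsMotic ↔
    ∀ e ∈ γ, (G.MM γ → G.MM (γ.erase e)) → EndsConn G.ends (γ.erase e) e := by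
  have key (e : {e // e ∈ γ}) (s : Finset {e // e ∈ γ}) (hs : ∀ x, x ∈ s ↔ x ≠ e) :
      ((G.sub γ).MM s → EndsConn (G.sub γ).ends s e) ↔
      ((G.MM γ → G.MM (γ.erase e.1)) → EndsConn G.ends (γ.erase e.1) e.1) := by
    have h : G.subLift γ s = γ.erase e.1 := by
      ext x
      by_cases hx : x ∈ γ
      · rw [G.mem_subLift γ _ hx, hs]
        simp [hx, Subtype.ext_iff]
      · exact iff_of_false (fun h => hx (G.subLift_subset _ _ h))
          (fun h => hx (Finset.mem_of_mem_erase h))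
    rw [← h]
    exact imp_congr (G.sub_mm_iff γ s) (G.endsConn_sub_iff γ s e)
  rw [isMotic_iff]
  refine Iff.trans (forall_congr' fun e => key e _ fun x => ?_) (Subtype.forall (p := (· ∈ γ))
    (q := fun e => (G.MM γ → G.MM (γ.erase e.1)) → EndsConn G.ends (γ.erase e.1) e.1))
  exact (Finset.mem_erase (α := (G.sub γ).E)).trans (and_iff_left (Finset.mem_univ _))

/-! ### Contractions -/

theorem mem_conEnds {e : {e // e ∉ γ}} {a : G.ConVert γ} :
    a ∈ G.conEnds γ e ↔ ∃ v ∈ G.ends e.1, Quotient.mk _ v = a.1 := by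
  rw [← Sym2.mem_map, ← G.conEnds_map γ e, Sym2.mem_map]
  exact ⟨fun h => ⟨a, h, rfl⟩, fun ⟨_, h, h'⟩ => Subtype.ext h' ▸ h⟩

theorem conLift_erase (μ : Finset {e // e ∉ γ}) (e : {e // e ∉ γ}) :
    G.conLift γ (μ.erase e) = (G.conLift γ μ).erase e.1 := by
  ext x
  by_cases hx : x ∈ γ
  · have : x ≠ e.1 := fun h => e.2 (h ▸ hx)
    simp [G.subset_conLift γ _ hx, this]
  · simp [G.mem_conLift γ _ hx, Subtype.ext_iff]

theorem endsConn_contract_iff (μ : Finset {e // e ∉ γ}) (e : {e // e ∉ γ}) :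
    EndsConn (G.conEnds γ) μ e ↔ EndsConn G.ends (G.conLift γ μ) e.1 := by
  constructor
  · intro h u hu v hv
    exact (G.conEnds_conn γ μ (a := ⟨Quotient.mk _ u, _, e.2, Sym2.mem_map.2 ⟨u, hu, rfl⟩⟩)
      (b := ⟨Quotient.mk _ v, _, e.2, Sym2.mem_map.2 ⟨v, hv, rfl⟩⟩) rfl rfl).1
      (h _ ((G.mem_conEnds γ).2 ⟨u, hu, rfl⟩) _ ((G.mem_conEnds γ).2 ⟨v, hv, rfl⟩))
  · intro h a ha b hb
    obtain ⟨u, hu, ha⟩ := (G.mem_conEnds γ).1 ha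
    obtain ⟨v, hv, hb⟩ := (G.mem_conEnds γ).1 hb
    exact (G.conEnds_conn γ μ ha.symm hb.symm).2 (h u hu v hv)

/-- By non-exceptionality, the momenta entering at a contracted vertex only cancel if it swallows
all the external vertices of its component. -/
theorem edgeConn_of_conMomentum_eq_zero {u v : G.V} (hu : G.IsExternal u) (hv : G.IsExternal v)
    (huv : edgeConn G.ends Finset.univ u v) {a : G.ConVert γ} (ha : a.1 = Quotient.mk _ u)
    (h0 : G.conMomentum γ a = 0) : edgeConn G.ends γ u v := by
  have := G.nonexceptional
    {v | Quotient.mk _ v = a.1 ∧ G.IsExternal v} ⟨u, by simp [ha, hu]⟩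
    (by intro v hv; simp only [Finset.mem_filter] at hv; exact hv.2.2)
    (by
      intro x hx y hy
      simp only [Finset.mem_filter, Finset.mem_univ, true_and] at hx hy
      exact edgeConn_mono (Finset.subset_univ _) (Quotient.exact (hx.1.trans hy.1.symm)))
    (by
      rw [← h0, conMomentum, ← Finset.filter_filter]
      exact sum_filter_external G _)
    u (by simp [ha, hu]) v huv hv
  simp only [Finset.mem_filter, Finset.mem_univ, true_and] at this
  exact Quotient.exact (ha.symm.trans this.1.symm)

/-- A contracted vertex with nonzero momentum contains an external vertex of `G`. If external
momenta cancel in a contracted vertex, then `γ` already joins all the external vertices of that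
component of `G`, and nothing is lost by forgetting them. -/
theorem contract_mm_iff (c : ℝ) (μ : Finset {e // e ∉ γ}) :
    (G.contract γ c).MM μ ↔ G.MM (G.conLift γ μ) := by
  constructor
  · intro hmm
    refine ⟨fun e he => ?_, fun u v hu hv huv => ?_⟩
    · by_cases heγ : e ∈ γ
      · exact G.subset_conLift γ μ heγ
      · exact (G.mem_conLift γ μ heγ).2 (hmm.1 ⟨e, heγ⟩ he)
    · have h := huv
      -- A class may be missing from `G / γ` as an isolated vertex. The case split supplies vertices
      -- `a`, `b` of `G / γ` over `u`, `v` unless `γ` already joins `u` and `v`.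
      rw [← G.conLift_univ γ] at h
      rcases G.conEnds_conn_aux γ _ h with h | ⟨a, b, ha, hb, h⟩
      · exact edgeConn_mono (G.subset_conLift γ μ) h
      by_cases ha0 : G.conMomentum γ a = 0
      · exact edgeConn_mono (G.subset_conLift γ μ)
          (G.edgeConn_of_conMomentum_eq_zero γ hu hv huv ha ha0)
      by_cases hb0 : G.conMomentum γ b = 0
      · exact edgeConn_symm (edgeConn_mono (G.subset_conLift γ μ)
          (G.edgeConn_of_conMomentum_eq_zero γ hv hu (edgeConn_symm huv) hb hb0))
      exact (G.conEnds_conn γ μ ha hb).1 (hmm.2 a b ha0 hb0 h)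
  · rintro ⟨h1, h2⟩
    refine ⟨fun e he => (G.mem_conLift γ μ e.2).1 (h1 e.1 he), fun a b ha hb hab => ?_⟩
    obtain ⟨u, hua, hu⟩ := G.exists_external_of_conMomentum γ ha
    obtain ⟨v, hvb, hv⟩ := G.exists_external_of_conMomentum γ hb
    exact (G.conEnds_conn γ μ hua.symm hvb.symm).2
      (h2 u v hu hv ((G.conEnds_conn_univ γ hua.symm hvb.symm).1 hab))

/-- This is the criterion `sub_isMotic_iff` for the preimage in `G`, imposed only on edges outside
`γ`: contraction changes neither spanning nor the connectivity of the ends of such edges. -/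
theorem contract_sub_isMotic_iff (c : ℝ) (μ : Finset {e // e ∉ γ}) :
    ((G.contract γ c).sub μ).IsMotic ↔ ∀ e ∈ G.conLift γ μ, e ∉ γ →
      (G.MM (G.conLift γ μ) → G.MM ((G.conLift γ μ).erase e)) →
        EndsConn G.ends ((G.conLift γ μ).erase e) e := by
  have key (e : {e // e ∉ γ}) (s : Finset {e // e ∉ γ}) (hs : ∀ x, x ∈ s ↔ x ≠ e ∧ x ∈ μ) :
      (((G.contract γ c).MM μ → (G.contract γ c).MM s) → EndsConn (G.contract γ c).ends s e) ↔
      ((G.MM (G.conLift γ μ) → G.MM ((G.conLift γ μ).erase e)) →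
        EndsConn G.ends ((G.conLift γ μ).erase e) e) := by
    obtain rfl : s = μ.erase e := Finset.ext fun x => (hs x).trans Finset.mem_erase.symm
    rw [← G.conLift_erase]
    exact imp_congr (imp_congr (G.contract_mm_iff γ c _) (G.contract_mm_iff γ c _))
      (G.endsConn_contract_iff γ _ e)
  refine (sub_isMotic_iff (G.contract γ c) μ).trans ?_
  constructor
  · intro h e he heγ
    refine (key ⟨e, heγ⟩ _ fun x => ?_).1 (h _ ((G.mem_conLift γ μ heγ).1 he))
    exact Finset.mem_erase (α := (G.contract γ c).E)
  · intro h e he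
    refine (key e _ fun x => ?_).2 (h e.1 ((G.mem_conLift γ μ e.2).2 he) e.2)
    exact Finset.mem_erase (α := (G.contract γ c).E)

/-- Extensions of motic graphs by motic graphs are motic. -/
theorem isMotic_conLift_iff (c : ℝ) (μ : Finset {e // e ∉ γ}) (hγ : (G.sub γ).IsMotic) :
    (G.sub (G.conLift γ μ)).IsMotic ↔ ((G.contract γ c).sub μ).IsMotic := by
  rw [contract_sub_isMotic_iff, sub_isMotic_iff]
  refine ⟨fun h e he _ => h e he, fun h e he hmm => ?_⟩
  by_cases heγ : e ∈ γ
  swap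
  · exact h e he heγ hmm
  have hsub : γ.erase e ⊆ (G.conLift γ μ).erase e :=
    Finset.erase_subset_erase _ (G.subset_conLift γ μ)
  by_cases hm : G.MM γ → G.MM (γ.erase e)
  -- Here the condition on `e` in `γ` applies. In the remaining case `γ` is mm, and deleting `e`
  -- destroys this.
  · exact ((G.sub_isMotic_iff γ).1 hγ e heγ hm).mono hsub
  push Not at hm
  have hl := hmm (hm.1.mono (G.subset_conLift γ μ))
  -- The lift without `e` is mm and so contains all massive edges. Hence `e` is massless, and
  -- `γ.erase e` can fail only by disconnecting external vertices.
  have hms : G.MassSpanning (γ.erase e) := fun x hx =>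
    Finset.mem_erase.2 ⟨Finset.ne_of_mem_erase (hl.1 x hx), hm.1.1 x hx⟩
  have hps : ¬ G.MomentumSpanning (γ.erase e) := fun h => hm.2 ⟨hms, h⟩
  simp only [MomentumSpanning, not_forall] at hps
  obtain ⟨u, v, hu, hv, huv, hne⟩ := hps
  exact endsConn_of_separating hsub (hm.1.2 u v hu hv huv) hne (hl.2 u v hu hv huv)

end FeynmanGraph

/-! ### Isomorphisms between iterated subgraphs and contractions -/

namespace FeynmanGraph
variable {P : Type*} [AddCommGroup P] (G : FeynmanGraph P) (γ : Finset G.E)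

/-! ### Subgraphs of subgraphs -/

/-- Inheritance in two stages agrees with inheritance in one, because a subgraph that is not mm
contains no mm subgraph. It serves for masses and momenta alike. -/
theorem ite_sub_mm {α : Type*} [Zero α] (δ : Finset {e // e ∈ γ}) (x : α) :
    (if (G.sub γ).MM δ then (if G.MM γ then x else 0) else 0) =
      if G.MM (G.subLift γ δ) then x else 0 := by
  rw [G.sub_mm_iff]
  by_cases h : G.MM γ
  · simp [h]
  · have h' : ¬ G.MM (G.subLift γ δ) := fun h' => h (h'.mono (G.subLift_subset γ δ))
    simp [h, h']

/-- A subgraph of a subgraph is a subgraph. -/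
noncomputable def subSubIso (δ : Finset {e // e ∈ γ}) :
    Iso ((G.sub γ).sub δ) (G.sub (G.subLift γ δ)) where
  vertexEquiv :=
    { toFun := fun v => ⟨v.1.1, (G.mem_verts_sub γ δ v.1).1 v.2⟩
      invFun := fun v => ⟨⟨v.1, verts_mono (G.subLift_subset γ δ) v.2⟩,
        (G.mem_verts_sub γ δ _).2 v.2⟩
      left_inv := fun _ => rfl
      right_inv := fun _ => rfl }
  edgeEquiv :=
    { toFun := fun e => ⟨e.1.1, (G.mem_subLift γ δ e.1.2).2 e.2⟩
      invFun := fun e => ⟨⟨e.1, G.subLift_subset γ δ e.2⟩, (G.mem_subLift γ δ _).1 e.2⟩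
      left_inv := fun _ => rfl
      right_inv := fun _ => rfl }
  ends_eq e := by
    -- Ends are compared in `G`, where both sides have the original end points of the edge.
    apply Sym2.map.injective Subtype.val_injective
    refine (G.subEnds_map _ _).trans ?_
    refine ((G.subEnds_map γ e.1).symm.trans
      (congrArg _ ((G.sub γ).subEnds_map δ e).symm)).trans ?_
    change _ = Sym2.map _ (Sym2.map _ ((G.sub γ).subEnds δ e))
    generalize (G.sub γ).subEnds δ e = x
    induction x using Sym2.ind
    rfl
  mass_eq e := (G.ite_sub_mm γ δ _).symm
  edgeWeight_eq e := rfl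
  vertexWeight_eq v := rfl
  momentum_eq v := (G.ite_sub_mm γ δ _).symm

/-! ### Contractions in subgraphs -/

/-- The edges of `γ` as a subgraph of `G / δ`. -/
noncomputable def conRestrict (δ γ : Finset G.E) : Finset {e // e ∉ δ} := {e | e.1 ∈ γ}

theorem mem_conRestrict {δ γ : Finset G.E} {e : {e // e ∉ δ}} :
    e ∈ G.conRestrict δ γ ↔ e.1 ∈ γ := by simp [conRestrict]

theorem conLift_conRestrict {δ γ : Finset G.E} (h : δ ⊆ γ) :
    G.conLift δ (G.conRestrict δ γ) = γ := by
  ext e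
  by_cases he : e ∈ δ
  · exact iff_of_true (G.subset_conLift δ _ he) (h he)
  · rw [G.mem_conLift δ _ he, mem_conRestrict]

theorem conRestrict_conLift (δ : Finset G.E) (μ : Finset {e // e ∉ δ}) :
    G.conRestrict δ (G.conLift δ μ) = μ := by
  ext e
  rw [mem_conRestrict, G.mem_conLift δ μ e.2]

/-- The components of a subgraph `δ` of `γ`, as components of `δ` in `G`. -/
def subQuot (δ : Finset {e // e ∈ γ}) (q : Quotient (edgeConn (G.subEnds γ) δ)) :
    Quotient (edgeConn G.ends (G.subLift γ δ)) :=
  Quotient.map' Subtype.val (fun _ _ h => (G.subEnds_conn_iff γ δ _ _).1 h) q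

theorem subQuot_injective (δ : Finset {e // e ∈ γ}) : Function.Injective (G.subQuot γ δ) := by
  intro p q h
  induction p using Quotient.inductionOn with | _ u =>
  induction q using Quotient.inductionOn with | _ v =>
  exact Quotient.sound ((G.subEnds_conn_iff γ δ u v).2 (Quotient.exact h))

/-- Vertices outside `γ` are isolated with respect to `δ`. A class that meets the vertices of `γ`
therefore consists of them, and sums over it may be taken in either graph. -/
theorem mk_eq_subQuot_iff {δ : Finset {e // e ∈ γ}} {q : Quotient (edgeConn (G.subEnds γ) δ)}
    {v : G.V} : Quotient.mk _ v = G.subQuot γ δ q ↔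
      ∃ w : {v // v ∈ G.verts γ}, Quotient.mk _ w = q ∧ w.1 = v := by
  constructor
  · intro h
    induction q using Quotient.inductionOn with | _ u =>
    have huv : edgeConn G.ends (G.subLift γ δ) v u.1 := Quotient.exact h
    have hv : v ∈ G.verts γ := by
      by_contra hv
      have := G.eq_of_edgeConn_of_notMem γ hv (edgeConn_mono (G.subLift_subset γ δ) huv)
      exact hv (this ▸ u.2)
    exact ⟨⟨v, hv⟩, Quotient.sound ((G.subEnds_conn_iff γ δ _ _).2 huv), rfl⟩
  · rintro ⟨w, rfl, rfl⟩
    rfl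

theorem sum_subQuot {M : Type*} [AddCommMonoid M] (δ : Finset {e // e ∈ γ})
    (q : Quotient (edgeConn (G.subEnds γ) δ)) (f : G.V → M) :
    ∑ v with Quotient.mk _ v = G.subQuot γ δ q, f v =
      ∑ v : {v // v ∈ G.verts γ} with Quotient.mk _ v = q, f v.1 := by
  symm
  refine Finset.sum_bij (fun v _ => v.1) ?_ ?_ ?_ fun _ _ => rfl
  · intro v hv
    exact Finset.mem_filter.2 ⟨Finset.mem_univ _,
      (G.mk_eq_subQuot_iff γ).2 ⟨v, (Finset.mem_filter.1 hv).2, rfl⟩⟩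
  · intro _ _ _ _ h
    exact Subtype.ext h
  · intro v hv
    obtain ⟨w, hw, h⟩ := (G.mk_eq_subQuot_iff γ).1 (Finset.mem_filter.1 hv).2
    exact ⟨w, Finset.mem_filter.2 ⟨Finset.mem_univ _, hw⟩, h⟩

theorem map_subQuot (δ : Finset {e // e ∈ γ}) (e : {e // e ∈ γ}) :
    ((G.subEnds γ e).map (Quotient.mk (edgeConn (G.subEnds γ) δ))).map (G.subQuot γ δ) =
      (G.ends e.1).map (Quotient.mk _) := by
  rw [← G.subEnds_map γ e, Sym2.map_map, Sym2.map_map]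
  rfl

theorem subQuot_prop (δ : Finset {e // e ∈ γ}) (q : (G.sub γ).ConVert δ) :
    ∃ e ∈ γ, e ∉ G.subLift γ δ ∧ G.subQuot γ δ q.1 ∈ (G.ends e).map (Quotient.mk _) := by
  obtain ⟨e, he, hq⟩ := q.2
  refine ⟨e.1, e.2, fun h => he ((G.mem_subLift γ δ e.2).1 h), ?_⟩
  rw [← G.map_subQuot γ δ e]
  exact Sym2.mem_map.2 ⟨_, hq, rfl⟩

/-- The vertices of `γ / δ` as vertices of `G / δ`. -/
def subConVert (δ : Finset {e // e ∈ γ}) (q : (G.sub γ).ConVert δ) :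
    G.ConVert (G.subLift γ δ) :=
  ⟨G.subQuot γ δ q.1, (G.subQuot_prop γ δ q).imp fun _ h => h.2⟩

theorem subConVert_mem_verts (c : ℝ) (δ : Finset {e // e ∈ γ}) (q : (G.sub γ).ConVert δ) :
    G.subConVert γ δ q ∈
      (G.contract (G.subLift γ δ) c).verts (G.conRestrict (G.subLift γ δ) γ) := by
  obtain ⟨e, heγ, he, hq⟩ := G.subQuot_prop γ δ q
  obtain ⟨v, hv, h⟩ := Sym2.mem_map.1 hq
  exact ((G.contract _ c).mem_verts _).2 ⟨⟨e, he⟩, G.mem_conRestrict.2 heγ,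
    (G.mem_conEnds _).2 ⟨v, hv, h⟩⟩

/-- The vertices of `γ / δ` are the classes met by an edge of `γ` outside `δ`, and these are also
the end points of the image of `γ` in `G / δ`. -/
theorem subConVert_bijective (c : ℝ) (δ : Finset {e // e ∈ γ}) : Function.Bijective
    (fun q : (G.sub γ).ConVert δ => (⟨G.subConVert γ δ q, G.subConVert_mem_verts γ c δ q⟩ :
      {v // v ∈ (G.contract (G.subLift γ δ) c).verts (G.conRestrict (G.subLift γ δ) γ)})) := by
  constructor
  · intro p q h
    exact Subtype.ext (G.subQuot_injective γ δ (congrArg (fun x => x.1.1) h))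
  · rintro ⟨a, ha⟩
    obtain ⟨e, he, hae⟩ := ((G.contract _ c).mem_verts _).1 ha
    have heγ := G.mem_conRestrict.1 he
    obtain ⟨v, hv, h⟩ := (G.mem_conEnds _).1 hae
    have hvγ : v ∈ G.verts γ := (G.mem_verts γ).2 ⟨_, heγ, hv⟩
    refine ⟨⟨Quotient.mk _ ⟨v, hvγ⟩, ⟨e.1, heγ⟩,
      fun h => e.2 ((G.mem_subLift γ δ heγ).2 h), Sym2.mem_map.2
        ⟨⟨v, hvγ⟩, (G.mem_subEnds γ).2 hv, rfl⟩⟩, ?_⟩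
    exact Subtype.ext (Subtype.ext h)

theorem contract_mm_conRestrict_iff (c : ℝ) {δ γ : Finset G.E} (h : δ ⊆ γ) :
    (G.contract δ c).MM (G.conRestrict δ γ) ↔ G.MM γ := by
  rw [G.contract_mm_iff, G.conLift_conRestrict h]

/-- Contractions in a subgraph are subgraphs of contractions. -/
noncomputable def subContractIso (c : ℝ) (δ : Finset {e // e ∈ γ}) :
    Iso ((G.sub γ).contract δ c)
      ((G.contract (G.subLift γ δ) c).sub (G.conRestrict (G.subLift γ δ) γ)) where
  vertexEquiv := Equiv.ofBijective _ (G.subConVert_bijective γ c δ)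
  edgeEquiv :=
    { toFun := fun e => ⟨⟨e.1.1, fun h => e.2 ((G.mem_subLift γ δ e.1.2).1 h)⟩,
        G.mem_conRestrict.2 e.1.2⟩
      invFun := fun e => ⟨⟨e.1.1, G.mem_conRestrict.1 e.2⟩,
        fun h => e.1.2 ((G.mem_subLift γ δ _).2 h)⟩
      left_inv := fun _ => rfl
      right_inv := fun _ => rfl }
  ends_eq e := by
    apply Sym2.map.injective Subtype.val_injective
    refine ((G.contract _ c).subEnds_map _ _).trans ?_
    apply Sym2.map.injective Subtype.val_injective
    refine (G.conEnds_map _ _).trans ((G.map_subQuot γ δ e.1).symm.trans ?_)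
    refine (congrArg _ ((G.sub γ).conEnds_map δ e).symm).trans ?_
    change _ = Sym2.map _ (Sym2.map _ (Sym2.map _ ((G.sub γ).conEnds δ e)))
    generalize (G.sub γ).conEnds δ e = x
    induction x using Sym2.ind
    rfl
  mass_eq e := if_congr (G.contract_mm_conRestrict_iff c (G.subLift_subset γ δ)) rfl rfl
  edgeWeight_eq e := rfl
  vertexWeight_eq q := by
    refine if_congr ?_ rfl (G.sum_subQuot γ δ q.1 G.vertexWeight)
    constructor
    · rintro ⟨v, hv, h⟩
      obtain ⟨w, hw, rfl⟩ := (G.mk_eq_subQuot_iff γ).1 h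
      exact ⟨w, (G.mem_verts_sub γ δ w).2 hv, hw⟩
    · rintro ⟨w, hw, h⟩
      exact ⟨w.1, (G.mem_verts_sub γ δ w).1 hw, (G.mk_eq_subQuot_iff γ).2 ⟨w, h, rfl⟩⟩
  momentum_eq q := by
    refine (if_congr (G.contract_mm_conRestrict_iff c (G.subLift_subset γ δ))
      (G.sum_subQuot γ δ q.1 G.momentum) rfl).trans ?_
    change _ = ∑ v : {v // v ∈ G.verts γ} with Quotient.mk _ v = q.1,
      if G.MM γ then G.momentum v.1 else 0
    -- If `γ` is not mm, its momenta are dropped before the contraction on one side and after it on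
    -- the other.
    split_ifs
    · rfl
    · exact Finset.sum_const_zero.symm

/-! ### Contractions of contractions -/

variable (μ : Finset {e // e ∉ γ})

/-- The components of a subgraph of `G / γ`, as components of its preimage in `G`. -/
noncomputable def conQuot (q : Quotient (edgeConn (G.conEnds γ) μ)) :
    Quotient (edgeConn G.ends (G.conLift γ μ)) :=
  Quotient.lift (fun a : G.ConVert γ =>
    Quotient.map' id (fun _ _ h => edgeConn_mono (G.subset_conLift γ μ) h) a.1)
    (fun a b h => by
      obtain ⟨u, hu⟩ := Quotient.exists_rep a.1
      obtain ⟨v, hv⟩ := Quotient.exists_rep b.1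
      rw [← hu, ← hv]
      exact Quotient.sound ((G.conEnds_conn γ μ hu.symm hv.symm).1 h)) q

theorem conQuot_mk {a : G.ConVert γ} {v : G.V} (h : a.1 = Quotient.mk _ v) :
    G.conQuot γ μ (Quotient.mk _ a) = Quotient.mk _ v := by
  change Quotient.map' id _ a.1 = _
  rw [h]
  rfl

theorem conQuot_injective : Function.Injective (G.conQuot γ μ) := by
  intro p q h
  induction p using Quotient.inductionOn with | _ a =>
  induction q using Quotient.inductionOn with | _ b =>
  obtain ⟨u, hu⟩ := Quotient.exists_rep a.1
  obtain ⟨v, hv⟩ := Quotient.exists_rep b.1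
  rw [G.conQuot_mk γ μ hu.symm, G.conQuot_mk γ μ hv.symm] at h
  exact Quotient.sound ((G.conEnds_conn γ μ hu.symm hv.symm).2 (Quotient.exact h))

/-- The preimage of a component of `μ` is a union of classes that are vertices of `G / γ`; classes
discarded as isolated never join it. -/
theorem mk_eq_conQuot_iff {q : Quotient (edgeConn (G.conEnds γ) μ)} {v : G.V} :
    Quotient.mk _ v = G.conQuot γ μ q ↔
      ∃ a : G.ConVert γ, Quotient.mk _ a = q ∧ Quotient.mk _ v = a.1 := by
  constructor
  · intro h
    induction q using Quotient.inductionOn with | _ b =>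
    obtain ⟨w, hw⟩ := Quotient.exists_rep b.1
    rw [G.conQuot_mk γ μ hw.symm] at h
    rcases G.conEnds_conn_aux γ μ (Quotient.exact h) with h | ⟨a, b', ha, hb, h⟩
    · exact ⟨b, rfl, (Quotient.sound h).trans hw⟩
    · obtain rfl : b' = b := Subtype.ext (hb.trans hw)
      exact ⟨a, Quotient.sound h, ha.symm⟩
  · rintro ⟨a, rfl, h⟩
    exact (G.conQuot_mk γ μ h.symm).symm

theorem map_conQuot (e : {e // e ∉ γ}) :
    ((G.conEnds γ e).map (Quotient.mk (edgeConn (G.conEnds γ) μ))).map (G.conQuot γ μ) =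
      (G.ends e.1).map (Quotient.mk _) := by
  have h := congrArg (Sym2.map (Quotient.map' (s₂ := edgeConn G.ends (G.conLift γ μ)) id
    (fun _ _ h => edgeConn_mono (G.subset_conLift γ μ) h))) (G.conEnds_map γ e)
  rw [Sym2.map_map, Sym2.map_map] at h
  rw [Sym2.map_map]
  exact h

theorem conQuot_prop (c : ℝ) (q : (G.contract γ c).ConVert μ) :
    ∃ e, e ∉ G.conLift γ μ ∧ G.conQuot γ μ q.1 ∈ (G.ends e).map (Quotient.mk _) := by
  obtain ⟨e, he, hq⟩ := q.2
  refine ⟨e.1, fun h => he ((G.mem_conLift γ μ e.2).1 h), ?_⟩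
  rw [← G.map_conQuot γ μ e]
  exact Sym2.mem_map.2 ⟨_, hq, rfl⟩

/-- A class that survives the joint contraction meets an edge outside the lift. This edge lies
outside `γ`, so its end survives the first contraction too. -/
theorem conConVert_bijective (c : ℝ) : Function.Bijective
    (fun q : (G.contract γ c).ConVert μ =>
      (⟨G.conQuot γ μ q.1, G.conQuot_prop γ μ c q⟩ : G.ConVert (G.conLift γ μ))) := by
  constructor
  · intro p q h
    exact Subtype.ext (G.conQuot_injective γ μ (congrArg Subtype.val h))
  · rintro ⟨x, e, he, hx⟩
    have heγ : e ∉ γ := fun h => he (G.subset_conLift γ μ h)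
    obtain ⟨v, hv, rfl⟩ := Sym2.mem_map.1 hx
    let a : G.ConVert γ := ⟨Quotient.mk _ v, e, heγ, Sym2.mem_map.2 ⟨v, hv, rfl⟩⟩
    refine ⟨⟨Quotient.mk _ a, ⟨e, heγ⟩, fun h => he ((G.mem_conLift γ μ heγ).2 h),
      Sym2.mem_map.2 ⟨a, (G.mem_conEnds γ).2 ⟨v, hv, rfl⟩, rfl⟩⟩, ?_⟩
    exact Subtype.ext (G.conQuot_mk γ μ (a := a) rfl)

theorem mem_verts_conLift {v : G.V} : v ∈ G.verts (G.conLift γ μ) ↔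
    v ∈ G.verts γ ∨ ∃ e ∈ μ, v ∈ G.ends e.1 := by
  simp only [mem_verts]
  constructor
  · rintro ⟨e, he, hv⟩
    by_cases h : e ∈ γ
    · exact .inl ⟨e, h, hv⟩
    · exact .inr ⟨⟨e, h⟩, (G.mem_conLift γ μ h).1 he, hv⟩
  · rintro (⟨e, he, hv⟩ | ⟨e, he, hv⟩)
    · exact ⟨e, G.subset_conLift γ μ he, hv⟩
    · exact ⟨e.1, (G.mem_conLift γ μ e.2).2 he, hv⟩

theorem mem_verts_contract_iff (c : ℝ) {a : G.ConVert γ} :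
    a ∈ (G.contract γ c).verts μ ↔ ∃ e ∈ μ, ∃ v ∈ G.ends e.1, Quotient.mk _ v = a.1 :=
  ((G.contract γ c).mem_verts μ).trans
    (exists_congr fun e => and_congr_right fun _ => G.mem_conEnds γ (e := e))

/-- A vertex touched by `μ` has weight `c` both ways. An untouched one is a single vertex of `G / γ`
and keeps its weight there, which is again `c` if `γ` was contracted to it. It matters that every
contraction assigns the same `c`. -/
theorem contract_contract_vertexWeight (c : ℝ) (q : (G.contract γ c).ConVert μ) :
    (if ∃ v ∈ G.verts (G.conLift γ μ), Quotient.mk _ v = G.conQuot γ μ q.1 then c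
      else ∑ v with Quotient.mk _ v = G.conQuot γ μ q.1, G.vertexWeight v) =
    if ∃ a ∈ (G.contract γ c).verts μ, Quotient.mk _ a = q.1 then c
      else ∑ a with Quotient.mk _ a = q.1, (G.contract γ c).vertexWeight a := by
  by_cases h : ∃ a ∈ (G.contract γ c).verts μ, Quotient.mk _ a = q.1
  · rw [if_pos h, if_pos]
    obtain ⟨a, ha, haq⟩ := h
    obtain ⟨e, he, v, hv, hva⟩ := (G.mem_verts_contract_iff γ μ c).1 ha
    exact ⟨v, (G.mem_verts_conLift γ μ).2 (.inr ⟨e, he, hv⟩),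
      (G.mk_eq_conQuot_iff γ μ).2 ⟨a, haq, hva⟩⟩
  · obtain ⟨a, ha⟩ := Quotient.exists_rep q.1
    have hsingle (b : G.ConVert γ) : Quotient.mk (edgeConn (G.conEnds γ) μ) b = q.1 ↔ b = a := by
      refine ⟨fun hb => ?_, fun hb => hb ▸ ha⟩
      have hna : a ∉ (G.contract γ c).verts μ := fun h' => h ⟨a, h', ha⟩
      exact ((G.contract γ c).eq_of_edgeConn_of_notMem μ hna
        (Quotient.exact (ha.trans hb.symm))).symm
    have hmk (v : G.V) : Quotient.mk _ v = G.conQuot γ μ q.1 ↔ Quotient.mk _ v = a.1 := by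
      refine (G.mk_eq_conQuot_iff γ μ).trans ?_
      exact ⟨fun ⟨b, hb, hv⟩ => (hsingle b).1 hb ▸ hv, fun hv => ⟨a, ha, hv⟩⟩
    have hv : (∃ v ∈ G.verts (G.conLift γ μ), Quotient.mk _ v = G.conQuot γ μ q.1) ↔
        ∃ v ∈ G.verts γ, Quotient.mk _ v = a.1 := by
      simp only [hmk, mem_verts_conLift]
      refine ⟨?_, fun ⟨v, hv, hva⟩ => ⟨v, .inl hv, hva⟩⟩
      rintro ⟨v, hv | ⟨e, he, hv⟩, hva⟩
      · exact ⟨v, hv, hva⟩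
      · exact absurd ⟨a, (G.mem_verts_contract_iff γ μ c).2 ⟨e, he, v, hv, hva⟩, ha⟩ h
    rw [if_neg h]
    refine Eq.trans ?_ (Finset.sum_eq_single a ?_ ?_).symm
    rotate_left
    · intro b hb hne
      rw [Finset.mem_filter] at hb
      exact absurd ((hsingle b).1 hb.2) hne
    · intro hn
      rw [Finset.mem_filter] at hn
      exact absurd ⟨Finset.mem_univ a, ha⟩ hn
    refine if_congr hv rfl (Finset.sum_congr (Finset.filter_congr fun v _ => hmk v) fun _ _ => rfl)

theorem sum_filter_momentum {p : G.ConVert γ → Prop} {p' : G.V → Prop} {_ : DecidablePred p}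
    {_ : DecidablePred p'} (h : ∀ v, p' v ↔ ∃ a, p a ∧ Quotient.mk _ v = a.1) :
    ∑ v with p' v, G.momentum v = ∑ a with p a, G.conMomentum γ a := by
  rw [sum_conMomentum]
  exact Finset.sum_congr (by ext; simp [h]) fun _ _ => rfl

/-- Successive contractions. -/
noncomputable def contractContractIso (c : ℝ) :
    Iso ((G.contract γ c).contract μ c) (G.contract (G.conLift γ μ) c) where
  vertexEquiv := Equiv.ofBijective _ (G.conConVert_bijective γ μ c)
  edgeEquiv :=
    { toFun := fun e => ⟨e.1.1, fun h => e.2 ((G.mem_conLift γ μ e.1.2).1 h)⟩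
      invFun := fun e => ⟨⟨e.1, fun h => e.2 (G.subset_conLift γ μ h)⟩,
        fun h => e.2 ((G.mem_conLift γ μ _).2 h)⟩
      left_inv := fun _ => rfl
      right_inv := fun _ => rfl }
  ends_eq e := by
    apply Sym2.map.injective Subtype.val_injective
    refine (G.conEnds_map _ _).trans ((G.map_conQuot γ μ e.1).symm.trans ?_)
    refine (congrArg _ ((G.contract γ c).conEnds_map μ e).symm).trans ?_
    change _ = Sym2.map _ (Sym2.map _ ((G.contract γ c).conEnds μ e))
    generalize (G.contract γ c).conEnds μ e = x
    induction x using Sym2.ind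
    rfl
  mass_eq e := rfl
  edgeWeight_eq e := rfl
  vertexWeight_eq q := G.contract_contract_vertexWeight γ μ c q
  momentum_eq q := G.sum_filter_momentum γ fun v => G.mk_eq_conQuot_iff γ μ

end FeynmanGraph

/-! ### Sums over chains of subgraphs -/

theorem Finset.sum_map_subtype {E M : Type*} [Fintype E] [AddCommMonoid M] (γ : Finset E)
    (F : Finset E → M) : ∑ δ : Finset {e // e ∈ γ}, F (δ.map (Function.Embedding.subtype _)) =
      ∑ δ : Finset E, if δ ⊆ γ then F δ else 0 := by
  rw [← Finset.sum_filter]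
  refine Finset.sum_bij (fun δ _ => δ.map (Function.Embedding.subtype _)) ?_ ?_ ?_ fun _ _ => rfl
  · intro δ _
    rw [Finset.mem_filter]
    refine ⟨Finset.mem_univ _, fun e he => ?_⟩
    obtain ⟨e, -, rfl⟩ := Finset.mem_map.1 he
    exact e.2
  · intro _ _ _ _ h
    exact Finset.map_injective _ h
  · intro δ hδ
    refine ⟨δ.subtype (· ∈ γ), Finset.mem_univ _, ?_⟩
    rw [Finset.subtype_map]
    exact Finset.filter_true_of_mem (Finset.mem_filter.1 hδ).2

namespace FeynmanGraph
variable {P : Type*} [AddCommGroup P]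

/-- The counterpart for contractions of `Finset.sum_map_subtype`. Indicators for `δ ⊆ γ` turn both
iterated coproducts into double sums over the same edge sets. -/
theorem sum_conLift {M : Type*} [AddCommMonoid M] (G : FeynmanGraph P) (δ : Finset G.E)
    (F : Finset G.E → M) : ∑ μ : Finset {e // e ∉ δ}, F (G.conLift δ μ) =
      ∑ γ : Finset G.E, if δ ⊆ γ then F γ else 0 := by
  rw [← Finset.sum_filter]
  refine Finset.sum_bij (fun μ _ => G.conLift δ μ) ?_ ?_ ?_ fun _ _ => rfl
  · intro μ _
    exact Finset.mem_filter.2 ⟨Finset.mem_univ _, G.subset_conLift δ μ⟩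
  · intro μ _ ν _ h
    rw [← G.conRestrict_conLift δ μ, h, conRestrict_conLift]
  · intro γ hγ
    exact ⟨G.conRestrict δ γ, Finset.mem_univ _,
      G.conLift_conRestrict (Finset.mem_filter.1 hγ).2⟩

theorem Iso.isMotic_iff {G H : FeynmanGraph P} (φ : G.Iso H) : G.IsMotic ↔ H.IsMotic :=
  ⟨φ.isMotic_aux, φ.symm.isMotic_aux⟩

end FeynmanGraph

/-! ### Coassociativity of the motic coproduct -/

namespace MoticSpace
variable {P : Type*} [AddCommGroup P]

/-- The basis element of a graph if it is motic, and zero otherwise. -/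
noncomputable def ofGraph (G : FeynmanGraph P) : MoticSpace P :=
  if hG : G.IsMotic then of G hG else 0

theorem ofGraph_of_isMotic {G : FeynmanGraph P} (hG : G.IsMotic) : ofGraph G = of G hG :=
  dif_pos hG

theorem ofGraph_of_not_isMotic {G : FeynmanGraph P} (hG : ¬ G.IsMotic) : ofGraph G = 0 :=
  dif_neg hG

theorem ofGraph_eq {G H : FeynmanGraph P} (φ : G.Iso H) : ofGraph G = ofGraph H := by
  by_cases hG : G.IsMotic
  · rw [ofGraph_of_isMotic hG, ofGraph_of_isMotic (φ.isMotic_iff.1 hG)]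
    exact of_eq _ _ φ
  · rw [ofGraph_of_not_isMotic hG, ofGraph_of_not_isMotic (mt φ.isMotic_iff.2 hG)]

/-- Since graphs that are not motic count as zero, the sum may run over all subgraphs. Only the left
factor restricts it, because contractions of a motic graph are motic. -/
theorem coproduct_ofGraph (c : ℝ) {G : FeynmanGraph P} (hG : G.IsMotic) :
    coproduct c (ofGraph G) =
      ∑ γ : Finset G.E, ofGraph (G.sub γ) ⊗ₜ[ℚ] ofGraph (G.contract γ c) := by
  have h : coproduct c (ofGraph G) =
      ∑ γ : {γ : Finset G.E // (G.sub γ).IsMotic},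
        of (G.sub γ) γ.2 ⊗ₜ[ℚ] of (G.contract γ c) (G.contract_isMotic γ c hG) := by
    rw [ofGraph_of_isMotic hG, of, coproduct, Finsupp.linearCombination_single, one_smul]
    rfl
  rw [h, ← Finset.sum_subset (Finset.filter_subset
    (fun γ : Finset G.E => (G.sub γ).IsMotic) Finset.univ), Finset.sum_subtype (p := fun γ =>
      (G.sub γ).IsMotic) _ (by simp)]
  · refine Finset.sum_congr rfl fun γ _ => ?_
    rw [ofGraph_of_isMotic γ.2, ofGraph_of_isMotic]
  · intro γ _ hγ
    rw [ofGraph_of_not_isMotic, TensorProduct.zero_tmul]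
    simpa using hγ

theorem coproduct_coassoc (c : ℝ) : doubleCoproduct (P := P) c =
    (coproduct c).lTensor (MoticSpace P) ∘ₗ coproduct c := by
  refine Finsupp.lhom_ext' fun x => LinearMap.ext_ring ?_
  induction x using Quotient.inductionOn with | _ G =>
  obtain ⟨G, hG⟩ := G
  have hof : Finsupp.lsingle (R := ℚ) (Quotient.mk (moticSetoid P) ⟨G, hG⟩) (1 : ℚ) =
      ofGraph G := (ofGraph_of_isMotic hG).symm
  simp only [LinearMap.comp_apply, hof, doubleCoproduct, LinearEquiv.coe_coe,
    coproduct_ofGraph c hG, map_sum, LinearMap.rTensor_tmul, LinearMap.lTensor_tmul]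
  -- The common summand of a chain `δ ⊆ γ`, with the middle factor realised inside `G / δ`.
  let T (δ γ : Finset G.E) : MoticSpace P ⊗[ℚ] (MoticSpace P ⊗[ℚ] MoticSpace P) :=
    ofGraph (G.sub δ) ⊗ₜ (ofGraph ((G.contract δ c).sub (G.conRestrict δ γ)) ⊗ₜ
      ofGraph (G.contract γ c))
  -- A `γ` that is not motic does not contribute on the left, so its terms must vanish on the right:
  -- if `δ` is motic, then `γ / δ` is not.
  have hT {δ γ : Finset G.E} (h : δ ⊆ γ) (hγ : ¬ (G.sub γ).IsMotic) : T δ γ = 0 := by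
    by_cases hδ : (G.sub δ).IsMotic
    · have h' := mt (G.isMotic_conLift_iff δ c (G.conRestrict δ γ) hδ).2
        (by rwa [G.conLift_conRestrict h])
      simp only [T, ofGraph_of_not_isMotic h', TensorProduct.zero_tmul, TensorProduct.tmul_zero]
    · simp only [T, ofGraph_of_not_isMotic hδ, TensorProduct.zero_tmul]
  have hleft (γ : Finset G.E) : TensorProduct.assoc ℚ _ _ _
      (coproduct c (ofGraph (G.sub γ)) ⊗ₜ[ℚ] ofGraph (G.contract γ c)) =
        ∑ δ : Finset G.E, if δ ⊆ γ then T δ γ else 0 := by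
    by_cases hγ : (G.sub γ).IsMotic
    · rw [coproduct_ofGraph c hγ, TensorProduct.sum_tmul, map_sum,
        ← Finset.sum_map_subtype γ (T · γ)]
      refine Finset.sum_congr rfl fun δ _ => ?_
      rw [TensorProduct.assoc_tmul, ofGraph_eq (G.subSubIso γ δ),
        ofGraph_eq (G.subContractIso γ c δ)]
      rfl
    · rw [ofGraph_of_not_isMotic hγ, map_zero, TensorProduct.zero_tmul, map_zero]
      refine (Finset.sum_eq_zero fun δ _ => ?_).symm
      split_ifs with h
      · exact hT h hγ
      · rfl
  -- No vanishing argument is needed here, since `G / δ` is motic for every `δ`.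
  have hright (δ : Finset G.E) :
      ofGraph (G.sub δ) ⊗ₜ[ℚ] coproduct c (ofGraph (G.contract δ c)) =
        ∑ γ : Finset G.E, if δ ⊆ γ then T δ γ else 0 := by
    rw [coproduct_ofGraph c (G.contract_isMotic δ c hG), TensorProduct.tmul_sum,
      ← G.sum_conLift δ (T δ)]
    refine Finset.sum_congr rfl fun μ _ => ?_
    -- Writing `μ` as the restriction of its own lift makes the summand depend on the lift alone.
    have h := congrArg (fun ν => ofGraph ((G.contract δ c).sub ν)) (G.conRestrict_conLift δ μ)
    exact congrArg _ (congrArg₂ _ h.symm (ofGraph_eq (G.contractContractIso δ μ c)))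
  simp only [hleft, hright]
  exact Finset.sum_comm

end MoticSpace

/-! ### From coassociativity to the two coactions -/

theorem theorem3p2 {P : Type*} [AddCommGroup P] (D c : ℝ) (k : FeynmanGraph.PieceKind) :
    (MoticSpace.coactionIR (P := P) D c k).lTensor (MoticSpace.HUV P D) ∘ₗ
          MoticSpace.coactionUV D c =
        (TensorProduct.assoc ℚ (MoticSpace.HUV P D) (MoticSpace P)
            (MoticSpace.HIR P D k)).toLinearMap ∘ₗ
          (MoticSpace.coactionUV D c).rTensor (MoticSpace.HIR P D k) ∘ₗ
            MoticSpace.coactionIR D c k ∧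
      (TensorProduct.assoc ℚ (MoticSpace.HUV P D) (MoticSpace P)
            (MoticSpace.HIR P D k)).toLinearMap ∘ₗ
          (MoticSpace.coactionUV D c).rTensor (MoticSpace.HIR P D k) ∘ₗ
            MoticSpace.coactionIR D c k =
        TensorProduct.map (MoticSpace.rhoUV D)
            (TensorProduct.map LinearMap.id (MoticSpace.rhoIR D k)) ∘ₗ
          MoticSpace.doubleCoproduct c ∧
      MoticSpace.doubleCoproduct (P := P) c =
        (MoticSpace.coproduct c).lTensor (MoticSpace P) ∘ₗ MoticSpace.coproduct c := by
  have h1 : (MoticSpace.coactionIR (P := P) D c k).lTensor (MoticSpace.HUV P D) ∘ₗ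
      MoticSpace.coactionUV D c = TensorProduct.map (MoticSpace.rhoUV D)
        (TensorProduct.map LinearMap.id (MoticSpace.rhoIR D k)) ∘ₗ
          (MoticSpace.coproduct c).lTensor (MoticSpace P) ∘ₗ MoticSpace.coproduct c := by
    simp only [MoticSpace.coactionUV, ← LinearMap.comp_assoc]
    -- Both sides begin with the coproduct. Once it is cancelled, what remains is functoriality of
    -- the tensor product, checked on pure tensors.
    congr 1
    refine TensorProduct.ext' fun x y => ?_
    simp [MoticSpace.coactionIR, LinearMap.lTensor]
  have h2 : (TensorProduct.assoc ℚ (MoticSpace.HUV P D) (MoticSpace P)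
      (MoticSpace.HIR P D k)).toLinearMap ∘ₗ
        (MoticSpace.coactionUV D c).rTensor (MoticSpace.HIR P D k) ∘ₗ
          MoticSpace.coactionIR D c k =
      TensorProduct.map (MoticSpace.rhoUV D)
        (TensorProduct.map LinearMap.id (MoticSpace.rhoIR D k)) ∘ₗ
          MoticSpace.doubleCoproduct c := by
    simp only [MoticSpace.coactionIR, MoticSpace.doubleCoproduct, ← LinearMap.comp_assoc]
    congr 1
    refine TensorProduct.ext' fun x y => ?_
    simp only [MoticSpace.coactionUV, LinearMap.comp_apply, LinearMap.lTensor_tmul,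
      LinearMap.rTensor_tmul, LinearEquiv.coe_coe]
    -- The associator is known on pure tensors, so the coproduct of the left factor has to be
    -- resolved into them.
    induction MoticSpace.coproduct c x using TensorProduct.induction_on with
    | zero => simp
    | tmul a b => simp
    | add a b ha hb => simp only [map_add, TensorProduct.add_tmul, ha, hb]
  have h3 := MoticSpace.coproduct_coassoc (P := P) c
  exact ⟨by rw [h1, h2, h3], h2, h3⟩
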